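/- **Theorem (Strong/Hellinger consistency).** Let $1\le p\le n$ and $C\ge 1$ be integers. Let $\mathcal V_{n,p}=\{X\in\mathbb R^{n\times p}: X^TX=I_p\}$ be the Stiefel manifold with its normalized Haar measure $[dX]$ (the unique $O(n)$-invariant probability measure), let $\widetilde{\mathcal V}_{n,p}$ be the set of $X\in\mathcal V_{n,p}$ whose first row has only positive entries, let $\mathcal S_p=\{d\in\mathbb R^p: 0<d_p<\dots<d_1\}$, and let $\mathbb S_\pi=\{\pi\in\mathbb R^C:\pi_c>0 \text{ for all } c,\ \sum_c\pi_c=1\}$. For $M\in\mathcal V_{n,p}$, $d\in\mathbb R^p$, $D=\mathrm{diag}(d)$ and $V\in\mathcal V_{p,p}=O(p)$, the matrix Langevin distribution $\mathcal{ML}(M,d,V)$ on $\mathcal V_{n,p}$ has density $$f_{\mathcal{ML}}(X;(M,d,V))=\frac{\exp(\mathrm{tr}(VDM^TX))}{{}_0F_1(\frac n2,\frac{D^2}{4})}$$ with respect to $[dX]$, where the normalizing constant is ${}_0F_1(\frac n2,\frac{D^2}4)=\int_{\mathcal V_{n,p}}\exp\big(\sum_{j=1}^p d_jX_{jj}\big)[dX]$.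 *Model.* The parameter space is $\Xi=(\widetilde{\mathcal V}_{n,p}\times\mathcal S_p\times\mathcal V_{p,p})^C\times\mathbb S_\pi$, and for $(\theta,\pi)\in\Xi$, $\theta=(M_c,d_c,V_c)_{c=1}^C$, put $f(X;(\theta,\pi))=\sum_{c=1}^C\pi_c f_{\mathcal{ML}}(X;(M_c,d_c,V_c))$. *Prior.* For each $c$ fix matrix Langevin hyperparameters $(A_c,a_c,B_c)\in\mathcal V_{n,p}\times\mathbb R^p\times O(p)$ for $M_c$ and $(A'_c,a'_c,B'_c)\in O(p)\times\mathbb R^p\times O(p)$ for $V_c$, and $\nu_c>0$, $\eta_c\in\mathbb R^p$, $\alpha_c>0$, such that $d\mapsto\exp(\nu_c\eta_c^Td)/{}_0F_1(\frac n2,\frac{D^2}4)^{\nu_c}$ is integrable over $(0,\infty)^p$; the distribution with density proportional to this function on $(0,\infty)^p$ is called $\mathrm{IMDY}(\nu_c,\eta_c)$. The prior $\Pi$ on $\Xi$ is given by independent $$M_c\sim\mathcal{ML}(A_c,a_c,B_c),\quad d_c\sim\mathrm{IMDY}(\nu_c,\eta_c),\quad V_c\sim\mathcal{ML}(A'_c,a'_c,B'_c),\quad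 \pi\sim\mathrm{Dirichlet}(\alpha_1,\dots,\alpha_C),$$ conditioned on $\Xi$ (that is, its density on $\Xi$ with respect to the product of the Haar, Lebesgue and simplex Lebesgue measures is proportional to the product of these densities). *Posterior.* Fix $(\theta_0,\pi_0)\in\Xi$, let $F_{\theta_0,\pi_0}$ be the distribution on $\mathcal V_{n,p}$ with density $f(\cdot;(\theta_0,\pi_0))$ with respect to $[dX]$, and let $X_1,X_2,\dots$ be independent with law $F_{\theta_0,\pi_0}$. For $A\subseteq\Xi$, $$\Pi(A\mid X_1,\dots,X_N)=\frac{\int_A R_N\,d\Pi}{\int_\Xi R_N\,d\Pi},\qquad R_N(\theta,\pi)=\prod_{i=1}^N\frac{f(X_i;(\theta,\pi))}{f(X_i;(\theta_0,\pi_0))}.$$ Then $\Pi$ and $F_{\theta_0,\pi_0}$ are probability measures, and $F_{\theta_0,\pi_0}^\infty$-almost surely the denominator $\int_\Xi R_N\,d\Pi$ is positive and finite for every $N$. Moreover, for every $\varepsilon>0$ and the Hellinger neighbourhood $$\mathcal W_\varepsilon=\Big\{(\theta,\pi)\in\Xi:\Big(\int_{\mathcal V_{n,p}}\big(\sqrt{f(X;(\theta_0,\pi_0))}-\sqrt{f(X;(\theta,\pi))}\big)^2[dX]\Big)^{1/2}<\varepsilon\Big\},$$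 one has $$\Pi(\Xi\setminus\mathcal W_\varepsilon\mid X_1,\dots,X_N)\longrightarrow 0\quad (N\to\infty)\qquad F_{\theta_0,\pi_0}^\infty\text{-almost surely}.$$ -/

import Mathlib

open MeasureTheory ProbabilityTheory Filter Topology

noncomputable section

namespace StiefelMixture

/-! ### The Stiefel manifold and its normalized Haar measure -/

/-- Real matrices carry the product (equivalently, the Borel) sigma-algebra. -/
instance instMeasurableSpaceMatrix (n p : ℕ) : MeasurableSpace (Matrix (Fin n) (Fin p) ℝ) :=
  inferInstanceAs (MeasurableSpace (Fin n → Fin p → ℝ))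

instance instBorelSpaceMatrix (n p : ℕ) : BorelSpace (Matrix (Fin n) (Fin p) ℝ) :=
  inferInstanceAs (BorelSpace (Fin n → Fin p → ℝ))

/-- The Stiefel manifold `V_{n,p}` of `n × p` real matrices with orthonormal columns, with the
subspace topology.  `Stiefel p p` is the space of orthogonal `p × p` matrices. -/
abbrev Stiefel (n p : ℕ) : Type :=
  {X : Matrix (Fin n) (Fin p) ℝ // X.transpose * X = 1}

instance instSecondCountableTopologyStiefel (n p : ℕ) : SecondCountableTopology (Stiefel n p) :=
  haveI : SecondCountableTopology (Matrix (Fin n) (Fin p) ℝ) :=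
    inferInstanceAs (SecondCountableTopology (Fin n → Fin p → ℝ))
  TopologicalSpace.Subtype.secondCountableTopology _

/-- The orthogonal group `O(n)` as a topological group. -/
abbrev OrthGroup (n : ℕ) : Type := Matrix.orthogonalGroup (Fin n) ℝ

instance instCompactSpaceOrthGroup (n : ℕ) : CompactSpace (OrthGroup n) := by
  have hclosed : IsClosed ((Matrix.orthogonalGroup (Fin n) ℝ : Submonoid _) :
      Set (Matrix (Fin n) (Fin n) ℝ)) := isClosed_unitary
  have hK : IsCompact (Set.pi Set.univ fun _ : Fin n =>
      Set.pi Set.univ fun _ : Fin n => Set.Icc (-1 : ℝ) 1) :=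
    isCompact_univ_pi fun _ => isCompact_univ_pi fun _ => isCompact_Icc
  refine isCompact_iff_compactSpace.mp (IsCompact.of_isClosed_subset hK hclosed ?_)
  intro Q hQ i _ j _
  have h := entry_norm_bound_of_unitary (𝕜 := ℝ) hQ i j
  rw [Real.norm_eq_abs] at h
  exact abs_le.mp h

/-- The first `p` columns of an orthogonal `n × n` matrix, for `p ≤ n`. -/
def frame {n p : ℕ} (h : p ≤ n) (Q : OrthGroup n) : Stiefel n p :=
  ⟨Q.1.submatrix id (Fin.castLE h), by
    have hQ : Q.1.transpose * Q.1 = 1 := (Matrix.mem_orthogonalGroup_iff' (Fin n) ℝ).mp Q.2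
    have hsub : (Q.1.submatrix id (Fin.castLE h)).transpose * Q.1.submatrix id (Fin.castLE h) =
        (Q.1.transpose * Q.1).submatrix (Fin.castLE h) (Fin.castLE h) := rfl
    rw [hsub, hQ]
    exact Matrix.submatrix_one _ (Fin.castLE_injective h)⟩

/-- The normalized Haar measure `[dX]` on `V_{n,p}` (the unique probability measure invariant
under left multiplication by `O(n)`): the law of the first `p` columns of a Haar-distributed
orthogonal matrix. -/
def stiefelHaar {n p : ℕ} (h : p ≤ n) : Measure (Stiefel n p) :=
  (Measure.haarMeasure (⊤ : TopologicalSpace.PositiveCompacts (OrthGroup n))).map (frame h)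

/-! ### Matrix Langevin distributions -/

/-- `etr A = exp (tr A)`. -/
def etr {p : ℕ} (A : Matrix (Fin p) (Fin p) ℝ) : ℝ := Real.exp A.trace

/-- The normalizing constant `₀F₁(n/2, D²/4)`, `D = diag d`, a function of `d` only:
`∫ etr(D Eᵀ X) [dX]`, where the columns of `E` are the first `p` standard basis vectors. -/
def hyp0F1 {n p : ℕ} (h : p ≤ n) (d : Fin p → ℝ) : ℝ :=
  ∫ X : Stiefel n p, etr (Matrix.diagonal d * (frame h 1).1.transpose * X.1) ∂(stiefelHaar h)

/-- A triple `(M, d, V)` with `M ∈ V_{n,p}`, `d ∈ ℝᵖ`, `V ∈ O(p)`. -/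
abbrev MLParam (n p : ℕ) : Type := Stiefel n p × (Fin p → ℝ) × Stiefel p p

/-- The matrix Langevin density `etr(V D Mᵀ X) / ₀F₁(n/2, D²/4)`. -/
def mlDensity {n p : ℕ} (h : p ≤ n) (θ : MLParam n p) (X : Stiefel n p) : ℝ :=
  etr (θ.2.2.1 * Matrix.diagonal θ.2.1 * θ.1.1.transpose * X.1) / hyp0F1 h θ.2.1

/-- The matrix Langevin distribution on `V_{n,p}`. -/
def mlMeasure {n p : ℕ} (h : p ≤ n) (θ : MLParam n p) : Measure (Stiefel n p) :=
  (stiefelHaar h).withDensity fun X => ENNReal.ofReal (mlDensity h θ X)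

/-! ### The mixture model -/

/-- Parameters `(θ, π)` of a `C`-component mixture, before the constraints. -/
abbrev MixParam (n p C : ℕ) : Type := (Fin C → MLParam n p) × (Fin C → ℝ)

/-- The elements of `V_{n,p}` whose first row is entrywise positive. -/
def firstRowPos (n p : ℕ) : Set (Stiefel n p) :=
  {M | ∀ (i : Fin n) (j : Fin p), i.val = 0 → 0 < M.1 i j}

/-- `S_p`: vectors with `0 < d_p < ⋯ < d_1`. -/
def decreasingPos (p : ℕ) : Set (Fin p → ℝ) := {d | (∀ j, 0 < d j) ∧ StrictAnti d}

/-- Probability vectors with positive entries. -/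
def openSimplex (C : ℕ) : Set (Fin C → ℝ) := {w | (∀ c, 0 < w c) ∧ ∑ c, w c = 1}

/-- The parameter space `Ξ`. -/
def paramSpace (n p C : ℕ) : Set (MixParam n p C) :=
  {ξ | (∀ c, (ξ.1 c).1 ∈ firstRowPos n p ∧ (ξ.1 c).2.1 ∈ decreasingPos p) ∧
    ξ.2 ∈ openSimplex C}

/-- The mixture density `f(X; (θ, π)) = ∑ π_c f_ML(X; θ_c)`. -/
def mixDensity {n p C : ℕ} (h : p ≤ n) (ξ : MixParam n p C) (X : Stiefel n p) : ℝ :=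
  ∑ c, ξ.2 c * mlDensity h (ξ.1 c) X

/-- The distribution `F_{θ,π}` with density `f(·; (θ, π))` with respect to `[dX]`. -/
def mixMeasure {n p C : ℕ} (h : p ≤ n) (ξ : MixParam n p C) : Measure (Stiefel n p) :=
  (stiefelHaar h).withDensity fun X => ENNReal.ofReal (mixDensity h ξ X)

/-! ### The prior -/

/-- A measure divided by its total mass. -/
def normalizeMeasure {Ω : Type*} [MeasurableSpace Ω] (μ : Measure Ω) : Measure Ω :=
  (μ Set.univ)⁻¹ • μ

/-- The unnormalized IMDY density `exp(ν ηᵀd) / ₀F₁(n/2, D²/4) ^ ν`. -/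
def imdyDensity {n p : ℕ} (h : p ≤ n) (ν : ℝ) (η : Fin p → ℝ) (d : Fin p → ℝ) : ℝ :=
  Real.exp (ν * ∑ j, η j * d j) / hyp0F1 h d ^ ν

/-- The positive orthant `ℝ₊ᵖ`. -/
def posOrthant (p : ℕ) : Set (Fin p → ℝ) := {d | ∀ j, 0 < d j}

/-- The IMDY distribution: density proportional to `imdyDensity` with respect to the Lebesgue
measure on the positive orthant. -/
def imdyMeasure {n p : ℕ} (h : p ≤ n) (ν : ℝ) (η : Fin p → ℝ) : Measure (Fin p → ℝ) :=
  normalizeMeasure ((volume.restrict (posOrthant p)).withDensity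
    fun d => ENNReal.ofReal (imdyDensity h ν η d))

/-- The Lebesgue measure on the simplex of probability vectors of length `C`: the image of the
Lebesgue measure in the first `C - 1` coordinates. -/
def simplexVolume (C : ℕ) : Measure (Fin C → ℝ) :=
  (volume.restrict {x : Fin (C - 1) → ℝ | (∀ i, 0 < x i) ∧ ∑ i, x i < 1}).map
    fun x c => if hc : c.val < C - 1 then x ⟨c.val, hc⟩ else 1 - ∑ i, x i

/-- The Dirichlet distribution: density proportional to `∏ w_c ^ (α_c - 1)` with respect to the
Lebesgue measure on the simplex. -/
def dirichletMeasure {C : ℕ} (α : Fin C → ℝ) : Measure (Fin C → ℝ) :=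
  normalizeMeasure ((simplexVolume C).withDensity
    fun w => ENNReal.ofReal (∏ c, w c ^ (α c - 1)))

/-- Hyperparameters of the prior: for each component `c`, the matrix Langevin hyperparameters of
`M_c` and of `V_c`, the IMDY hyperparameters `ν_c`, `η_c` of `d_c`, and the Dirichlet
hyperparameter `α_c`. -/
structure Hyper (n p C : ℕ) where
  mlM : Fin C → MLParam n p
  mlV : Fin C → MLParam p p
  ν : Fin C → ℝ
  η : Fin C → Fin p → ℝ
  α : Fin C → ℝ

/-- Independent `M_c ∼ ML`, `d_c ∼ IMDY`, `V_c ∼ ML`, `π ∼ Dirichlet`, without the constraints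
that define `Ξ`. -/
def productPrior {n p C : ℕ} (h : p ≤ n) (H : Hyper n p C) : Measure (MixParam n p C) :=
  (Measure.pi fun c => (mlMeasure h (H.mlM c)).prod
    ((imdyMeasure h (H.ν c) (H.η c)).prod (mlMeasure le_rfl (H.mlV c)))).prod
  (dirichletMeasure H.α)

/-- The prior `Π` on `Ξ`: its density is proportional on `Ξ` to the product of the component
densities, i.e. it is the product prior conditioned on `Ξ`. -/
def prior {n p C : ℕ} (h : p ≤ n) (H : Hyper n p C) : Measure (MixParam n p C) :=
  ProbabilityTheory.cond (productPrior h H) (paramSpace n p C)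

/-! ### The posterior and Hellinger neighbourhoods -/

/-- `R_N(ξ) = ∏_{i < N} f(X_i; ξ) / f(X_i; ξ₀)`. -/
def likelihoodRatio {n p C : ℕ} (h : p ≤ n) (ξ₀ : MixParam n p C) (x : ℕ → Stiefel n p) (N : ℕ)
    (ξ : MixParam n p C) : ℝ :=
  ∏ i ∈ Finset.range N, mixDensity h ξ (x i) / mixDensity h ξ₀ (x i)

/-- `∫_A R_N dΠ`. -/
def evidence {n p C : ℕ} (h : p ≤ n) (H : Hyper n p C) (ξ₀ : MixParam n p C)
    (x : ℕ → Stiefel n p) (N : ℕ) (A : Set (MixParam n p C)) : ENNReal :=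
  ∫⁻ ξ in A, ENNReal.ofReal (likelihoodRatio h ξ₀ x N ξ) ∂(prior h H)

/-- The posterior `Π(A | X_1, …, X_N) = ∫_A R_N dΠ / ∫_Ξ R_N dΠ`. -/
def posterior {n p C : ℕ} (h : p ≤ n) (H : Hyper n p C) (ξ₀ : MixParam n p C)
    (x : ℕ → Stiefel n p) (N : ℕ) (A : Set (MixParam n p C)) : ENNReal :=
  evidence h H ξ₀ x N A / evidence h H ξ₀ x N (paramSpace n p C)

/-- The Hellinger neighbourhood `W_ε(ξ₀)` in `Ξ`. -/
def hellingerNhd {n p C : ℕ} (h : p ≤ n) (ξ₀ : MixParam n p C) (ε : ℝ) : Set (MixParam n p C) :=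
  {ξ ∈ paramSpace n p C |
    Real.sqrt (∫ X, (Real.sqrt (mixDensity h ξ₀ X) - Real.sqrt (mixDensity h ξ X)) ^ 2
      ∂(stiefelHaar h)) < ε}

end StiefelMixture

end

noncomputable section

namespace StiefelMixture

/-! ### Topology and invariance of the Stiefel manifold -/

section StiefelManifold

variable {n p : ℕ} (h : p ≤ n)

/-! The argument is Schwartz's, with tests for single events and a compactness argument in place of
metric entropy. Write `F_ξ` for the mixture law and `f_ξ` for its density.

Lower bound on the evidence: the prior charges every neighbourhood of `ξ₀` inside the parameter
space, and since the Stiefel manifold is compact, `f_ξ ≥ s f_{ξ₀}` uniformly near `ξ₀` for any `s <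
1`. Hence the evidence is at least `c s ^ N` with `c > 0` (`exists_evidence_lower_bound`).

Tests: fix an event `A` and `δ > 0`. Weighting each observation by `exp (l (t - 1_A))` with `t =
F_{ξ₀}(A) + δ/2` gives a factor at most `s ^ 2` for every `ξ` with `F_ξ(A) ≥ F_{ξ₀}(A) + δ`, whereas
along the data the weights eventually have product at least `1` by the strong law. So the posterior
mass of these `ξ` tends to `0` almost surely (`ae_tendsto_posterior_mixProb_gt`).

From events to Hellinger distance: the sets on which the posterior almost surely concentrates form a
filter, and along it `F_ξ(A) → F_{ξ₀}(A)` for every measurable `A`. Membership in this filter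
concerns one set at a time, so the exceptional null sets may depend on `A`. It remains to show that
Hellinger neighbourhoods belong to every finer ultrafilter, i.e. that setwise convergence of
mixtures to `F_{ξ₀}` is convergence in `L¹`. Along an ultrafilter each component either has bounded
concentrations, and its weighted density converges in `L¹` by compactness, or its largest
concentration diverges. In that case, for `n ≥ 2`, it gathers on arbitrarily small caps around a
Haar-null set; since `F_{ξ₀}` gives these caps vanishing mass, the weight of the component tends to
`0` (`tendsto_weight_of_unbounded`). Thus `f_ξ` has an `L¹` limit, and setwise convergence
identifies it with `f_{ξ₀}`. For `n = 1` the manifold is finite and setwise convergence suffices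
directly. -/

lemma continuous_frame : Continuous (frame h : OrthGroup n → Stiefel n p) :=
  Continuous.subtype_mk (continuous_subtype_val.matrix_submatrix _ _) _

/-- Orthonormal columns extend to an orthogonal matrix. -/
lemma exists_orthGroup_columns (v : Fin n → EuclideanSpace ℝ (Fin n)) {s : Set (Fin n)}
    (hv : Orthonormal ℝ (s.domRestrict v)) :
    ∃ Q : OrthGroup n, ∀ j ∈ s, ∀ i, Q.1 i j = v j i := by
  obtain ⟨b, hb⟩ := hv.exists_orthonormalBasis_extension_of_card_eq (by simp)
  refine ⟨⟨Matrix.of fun i j => b j i, ?_⟩, fun j hj i => by simp [hb j hj]⟩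
  rw [Matrix.mem_orthogonalGroup_iff']
  ext j k
  have key := orthonormal_iff_ite.mp b.orthonormal k j
  rw [PiLp.inner_apply] at key
  simp only [RCLike.inner_apply, conj_trivial] at key
  simp only [Matrix.mul_apply, Matrix.transpose_apply, Matrix.of_apply, Matrix.one_apply]
  rw [key]
  simp [eq_comm]

lemma exists_frame_eq (M : Stiefel n p) : ∃ Q : OrthGroup n, frame h Q = M := by
  -- The zero vectors past column `p` are placeholders: orthonormality is required only on the
  -- indices below `p`.
  let v : Fin n → EuclideanSpace ℝ (Fin n) := fun j =>
    if hj : j.val < p then WithLp.toLp 2 (fun i => M.1 i ⟨j.val, hj⟩) else 0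
  have hv : Orthonormal ℝ (Set.domRestrict {j : Fin n | j.val < p} v) := by
    rw [orthonormal_iff_ite]
    rintro ⟨j, hj⟩ ⟨k, hk⟩
    have hj' : j.val < p := hj
    have hk' : k.val < p := hk
    have key := congrFun (congrFun M.2 ⟨k.val, hk'⟩) ⟨j.val, hj'⟩
    simp only [Matrix.mul_apply, Matrix.transpose_apply, Matrix.one_apply, Fin.mk.injEq] at key
    simp only [Set.domRestrict, v, hj', hk', dif_pos, PiLp.inner_apply, Subtype.mk.injEq]
    simp only [RCLike.inner_apply, conj_trivial]
    rw [key]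
    congr 1
    simp [Fin.ext_iff, eq_comm]
  obtain ⟨Q, hQ⟩ := exists_orthGroup_columns v hv
  refine ⟨Q, ?_⟩
  ext i j
  simp only [frame, Matrix.submatrix_apply, id]
  rw [hQ (Fin.castLE h j) j.2 i]
  simp [v]

instance instCompactSpaceStiefel (n p : ℕ) : CompactSpace (Stiefel n p) := by
  by_cases h : p ≤ n
  · have hs : Function.Surjective (frame h) := exists_frame_eq h
    rw [← isCompact_univ_iff, ← hs.range_eq]
    exact isCompact_range (continuous_frame h)
  · have : IsEmpty (Stiefel n p) := by
      refine ⟨fun M => h ?_⟩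
      have h1 := Matrix.rank_mul_le_right M.1.transpose M.1
      rw [M.2, Matrix.rank_one, Fintype.card_fin] at h1
      simpa using h1.trans M.1.rank_le_height
    infer_instance

instance instIsProbabilityMeasureStiefelHaar : IsProbabilityMeasure (stiefelHaar h) := by
  have : IsProbabilityMeasure
      (Measure.haarMeasure (⊤ : TopologicalSpace.PositiveCompacts (OrthGroup n))) :=
    ⟨by simpa using Measure.haarMeasure_self (K₀ := (⊤ : TopologicalSpace.PositiveCompacts (OrthGroup n)))⟩
  exact Measure.isProbabilityMeasure_map (continuous_frame h).measurable.aemeasurable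

instance instIsOpenPosMeasureStiefelHaar : (stiefelHaar h).IsOpenPosMeasure := by
  refine ⟨fun U hU hne => ?_⟩
  rw [stiefelHaar, Measure.map_apply (continuous_frame h).measurable hU.measurableSet]
  refine (hU.preimage (continuous_frame h)).measure_ne_zero _ ?_
  obtain ⟨M, hM⟩ := hne
  obtain ⟨Q, rfl⟩ := exists_frame_eq h M
  exact ⟨Q, hM⟩

/-- Compact groups are unimodular: the image of Haar measure under a right translation is again a
left-invariant probability measure, and such a measure is unique. -/
lemma measurePreserving_mul_right (R : OrthGroup n) :
    MeasurePreserving (fun Q : OrthGroup n => Q * R)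
      (Measure.haarMeasure (⊤ : TopologicalSpace.PositiveCompacts (OrthGroup n)))
      (Measure.haarMeasure ⊤) := by
  have hprob : IsProbabilityMeasure
      (Measure.haarMeasure (⊤ : TopologicalSpace.PositiveCompacts (OrthGroup n))) :=
    ⟨by simpa using Measure.haarMeasure_self (K₀ := (⊤ : TopologicalSpace.PositiveCompacts (OrthGroup n)))⟩
  have hm : Measurable (fun Q : OrthGroup n => Q * R) := (continuous_mul_const R).measurable
  refine ⟨hm, ?_⟩
  have : IsProbabilityMeasure ((Measure.haarMeasure
      (⊤ : TopologicalSpace.PositiveCompacts (OrthGroup n))).map (fun Q : OrthGroup n => Q * R)) :=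
    Measure.isProbabilityMeasure_map hm.aemeasurable
  exact Measure.isHaarMeasure_eq_of_isProbabilityMeasure _ _

/-- Multiplication of a frame by an orthogonal matrix on the left and on the right. -/
def twoSidedMul (Q : OrthGroup n) (W : OrthGroup p) (X : Stiefel n p) : Stiefel n p :=
  ⟨Q.1 * X.1 * W.1, by
    have hQ : Q.1.transpose * Q.1 = 1 := (Matrix.mem_orthogonalGroup_iff' (Fin n) ℝ).mp Q.2
    have hW : W.1.transpose * W.1 = 1 := (Matrix.mem_orthogonalGroup_iff' (Fin p) ℝ).mp W.2
    have hX := X.2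
    calc (Q.1 * X.1 * W.1).transpose * (Q.1 * X.1 * W.1)
        = W.1.transpose * (X.1.transpose * (Q.1.transpose * Q.1) * X.1) * W.1 := by
          simp only [Matrix.transpose_mul, Matrix.mul_assoc]
      _ = 1 := by rw [hQ, Matrix.mul_one, hX, Matrix.mul_one, hW]⟩

lemma continuous_twoSidedMul (Q : OrthGroup n) (W : OrthGroup p) :
    Continuous (twoSidedMul Q W) :=
  Continuous.subtype_mk ((continuous_const.matrix_mul continuous_subtype_val).matrix_mul
    continuous_const) _

/-- Lifts right multiplication of frames by `W` to a right translation of `O(n)`: `R` completes the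
frame `E W` to an orthogonal matrix, where `E = frame h 1`, and `frame h Q = Q E`. -/
lemma exists_frame_mul (W : OrthGroup p) :
    ∃ R : OrthGroup n, ∀ Q : OrthGroup n, (frame h (Q * R)).1 = (frame h Q).1 * W.1 := by
  obtain ⟨R, hR⟩ := exists_frame_eq h (twoSidedMul 1 W (frame h 1))
  refine ⟨R, fun Q => ?_⟩
  have hR' : R.1.submatrix id (Fin.castLE h) = (frame h 1).1 * W.1 := by
    have := congrArg Subtype.val hR
    simpa [twoSidedMul, frame] using this
  have h1 : (frame h (Q * R)).1 = Q.1 * R.1.submatrix id (Fin.castLE h) := rfl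
  have h2 : (frame h Q).1 = Q.1 * (frame h 1).1 := by
    have : (frame h Q).1 = (Q.1 * (1 : Matrix (Fin n) (Fin n) ℝ)).submatrix id (Fin.castLE h) := by
      rw [Matrix.mul_one]; rfl
    rw [this]; rfl
  rw [h1, hR', h2, Matrix.mul_assoc]

lemma measurePreserving_twoSidedMul (Q : OrthGroup n) (W : OrthGroup p) :
    MeasurePreserving (twoSidedMul Q W) (stiefelHaar h) (stiefelHaar h) := by
  have hf := (continuous_frame h).measurable
  have ht := (continuous_twoSidedMul Q W).measurable
  refine ⟨ht, ?_⟩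
  obtain ⟨R, hR⟩ := exists_frame_mul h W
  have hcomp : twoSidedMul Q W ∘ frame h = frame h ∘ fun P : OrthGroup n => Q * (P * R) := by
    funext P
    apply Subtype.ext
    have h1 : (frame h (Q * (P * R))).1 = Q.1 * (frame h (P * R)).1 := rfl
    simp only [Function.comp_apply, twoSidedMul]
    rw [h1, hR, Matrix.mul_assoc]
  have hmp : MeasurePreserving (fun P : OrthGroup n => Q * (P * R))
      (Measure.haarMeasure ⊤) (Measure.haarMeasure ⊤) :=
    (measurePreserving_mul_left _ Q).comp (measurePreserving_mul_right R)
  rw [stiefelHaar, Measure.map_map ht hf, hcomp, ← Measure.map_map hf hmp.measurable, hmp.map_eq]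

lemma mem_orthogonalGroup_of_stiefel (V : Stiefel p p) :
    V.1 ∈ Matrix.orthogonalGroup (Fin p) ℝ :=
  (Matrix.mem_orthogonalGroup_iff' (Fin p) ℝ).mpr V.2

/-- The `j`-th diagonal coordinate `(Mᵀ X V)_{jj}` of `X` relative to the frames `M` and `V`. -/
def diagCoord (M : Stiefel n p) (V : Stiefel p p) (X : Stiefel n p) (j : Fin p) : ℝ :=
  (M.1.transpose * X.1 * V.1) j j

/-- With `M = Q E`, one has `Mᵀ X V = Eᵀ (Q⁻¹ X V)`, and `X ↦ Q⁻¹ X V` preserves Haar measure. This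
reduces questions about general `M`, `V` to the standard frame. -/
lemma exists_measurePreserving_diagCoord (M : Stiefel n p) (V : Stiefel p p) :
    ∃ Φ : Stiefel n p → Stiefel n p, MeasurePreserving Φ (stiefelHaar h) (stiefelHaar h) ∧
      ∀ X j, diagCoord M V X j = (Φ X).1 (Fin.castLE h j) j := by
  obtain ⟨Q, rfl⟩ := exists_frame_eq h M
  refine ⟨_, measurePreserving_twoSidedMul h Q⁻¹ ⟨V.1, mem_orthogonalGroup_of_stiefel V⟩,
    fun X j => ?_⟩
  rfl

end StiefelManifold

/-! ### Matrix Langevin densities and their mixtures -/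

lemma continuous_integral_of_compactSpace {X Y : Type*} [TopologicalSpace X]
    [FirstCountableTopology X] [LocallyCompactSpace X] [TopologicalSpace Y] [CompactSpace Y]
    [SecondCountableTopology Y] [MeasurableSpace Y] [OpensMeasurableSpace Y] {μ : Measure Y}
    [IsFiniteMeasure μ] {f : X → Y → ℝ} (hf : Continuous f.uncurry) :
    Continuous fun x => ∫ y, f x y ∂μ := by
  have := continuous_parametric_integral_of_continuous (μ := μ) hf isCompact_univ
  simpa using this

lemma integrable_of_continuous_of_compactSpace {Y : Type*} [TopologicalSpace Y] [CompactSpace Y]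
    [MeasurableSpace Y] [OpensMeasurableSpace Y] {μ : Measure Y}
    [IsFiniteMeasure μ] {f : Y → ℝ} (hf : Continuous f) : Integrable f μ := by
  have := hf.continuousOn.integrableOn_compact' (μ := μ) isCompact_univ MeasurableSet.univ
  rwa [integrableOn_univ] at this

section Density

variable {n p C : ℕ} (h : p ≤ n)

lemma continuous_diagCoord (j : Fin p) :
    Continuous fun q : Stiefel n p × Stiefel p p × Stiefel n p =>
      diagCoord q.1 q.2.1 q.2.2 j := by
  unfold diagCoord
  have h1 : Continuous fun q : Stiefel n p × Stiefel p p × Stiefel n p =>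
      q.1.1.transpose * q.2.2.1 * q.2.1.1 :=
    (((continuous_subtype_val.comp continuous_fst).matrix_transpose).matrix_mul
      (continuous_subtype_val.comp (continuous_snd.comp continuous_snd))).matrix_mul
      (continuous_subtype_val.comp (continuous_fst.comp continuous_snd))
  exact h1.matrix_elem j j

lemma etr_eq_exp_sum_diagCoord (θ : MLParam n p) (X : Stiefel n p) :
    etr (θ.2.2.1 * Matrix.diagonal θ.2.1 * θ.1.1.transpose * X.1) =
      Real.exp (∑ j, θ.2.1 j * diagCoord θ.1 θ.2.2 X j) := by
  unfold etr diagCoord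
  congr 1
  rw [Matrix.mul_assoc, Matrix.mul_assoc, Matrix.trace_mul_comm, Matrix.mul_assoc, Matrix.trace]
  simp only [Matrix.diag_apply, Matrix.diagonal_mul]

lemma mlDensity_eq (θ : MLParam n p) (X : Stiefel n p) :
    mlDensity h θ X = Real.exp (∑ j, θ.2.1 j * diagCoord θ.1 θ.2.2 X j) / hyp0F1 h θ.2.1 := by
  rw [mlDensity, etr_eq_exp_sum_diagCoord]

lemma hyp0F1_eq (d : Fin p → ℝ) :
    hyp0F1 h d = ∫ X : Stiefel n p, Real.exp (∑ j, d j * X.1 (Fin.castLE h j) j)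
      ∂(stiefelHaar h) := by
  unfold hyp0F1
  congr 1
  funext X
  have key := etr_eq_exp_sum_diagCoord
    ((frame h 1, d, ⟨1, by simp⟩) : MLParam n p) X
  simp only [Matrix.one_mul] at key
  rw [key]
  congr 1
  refine Finset.sum_congr rfl fun j _ => ?_
  congr 1
  simp only [diagCoord, Matrix.mul_one]
  have : ((frame h 1).1.transpose * X.1) j j =
      ((1 : Matrix (Fin n) (Fin n) ℝ) * X.1) (Fin.castLE h j) j := by
    rw [Matrix.mul_apply, Matrix.mul_apply]
    refine Finset.sum_congr rfl fun i _ => ?_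
    simp [frame, Matrix.one_apply, eq_comm]
  rw [this, Matrix.one_mul]

lemma continuous_apply_stiefel (i : Fin n) (j : Fin p) :
    Continuous fun X : Stiefel n p => X.1 i j :=
  continuous_subtype_val.matrix_elem i j

lemma continuous_hyp0F1 : Continuous (hyp0F1 h) := by
  have : hyp0F1 h = fun d => ∫ X : Stiefel n p, Real.exp (∑ j, d j * X.1 (Fin.castLE h j) j)
      ∂(stiefelHaar h) := funext (hyp0F1_eq h)
  rw [this]
  refine continuous_integral_of_compactSpace ?_
  refine Real.continuous_exp.comp (continuous_finsetSum _ fun j _ => ?_)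
  exact ((continuous_apply j).comp continuous_fst).mul
    ((continuous_apply_stiefel _ j).comp continuous_snd)

lemma hyp0F1_pos (d : Fin p → ℝ) : 0 < hyp0F1 h d := by
  rw [hyp0F1_eq]
  refine integral_exp_pos (integrable_of_continuous_of_compactSpace ?_)
  exact Real.continuous_exp.comp (continuous_finsetSum _ fun j _ =>
    continuous_const.mul (continuous_apply_stiefel _ j))

lemma mlDensity_pos (θ : MLParam n p) (X : Stiefel n p) : 0 < mlDensity h θ X := by
  rw [mlDensity_eq]
  exact div_pos (Real.exp_pos _) (hyp0F1_pos h _)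

lemma continuous_mlDensity :
    Continuous fun q : MLParam n p × Stiefel n p => mlDensity h q.1 q.2 := by
  simp_rw [mlDensity_eq]
  refine Continuous.div ?_ ((continuous_hyp0F1 h).comp (by fun_prop))
    fun q => (hyp0F1_pos h _).ne'
  refine Real.continuous_exp.comp (continuous_finsetSum _ fun j _ => Continuous.mul (by fun_prop) ?_)
  exact (continuous_diagCoord j).comp
    (f := fun q : MLParam n p × Stiefel n p => (q.1.1, q.1.2.2, q.2)) (by fun_prop)

lemma continuous_mlDensity_right (θ : MLParam n p) : Continuous (mlDensity h θ) :=
  Continuous.comp (g := fun q : MLParam n p × Stiefel n p => mlDensity h q.1 q.2)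
    (f := fun X => (θ, X)) (continuous_mlDensity h) (by fun_prop)

/-- The change of variables to the standard frame explains why the normalizing constant depends on
`d` alone. -/
lemma integral_mlDensity (θ : MLParam n p) :
    ∫ X, mlDensity h θ X ∂(stiefelHaar h) = 1 := by
  obtain ⟨Φ, hΦ, hd⟩ := exists_measurePreserving_diagCoord h θ.1 θ.2.2
  simp_rw [mlDensity_eq, hd]
  rw [integral_div, div_eq_one_iff_eq (hyp0F1_pos h _).ne', hyp0F1_eq]
  have hc : Continuous fun X : Stiefel n p =>
      Real.exp (∑ j, θ.2.1 j * X.1 (Fin.castLE h j) j) :=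
    Real.continuous_exp.comp (continuous_finsetSum _ fun j _ =>
      continuous_const.mul (continuous_apply_stiefel _ j))
  conv_rhs => rw [← hΦ.map_eq]
  rw [integral_map hΦ.measurable.aemeasurable hc.aestronglyMeasurable]

lemma isProbabilityMeasure_withDensity_ofReal {Ω : Type*} [MeasurableSpace Ω] {μ : Measure Ω}
    {f : Ω → ℝ} (hf : Integrable f μ) (h0 : ∀ x, 0 ≤ f x) (h1 : ∫ x, f x ∂μ = 1) :
    IsProbabilityMeasure (μ.withDensity fun x => ENNReal.ofReal (f x)) := by
  refine ⟨?_⟩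
  rw [withDensity_apply _ MeasurableSet.univ, Measure.restrict_univ,
    ← ofReal_integral_eq_lintegral_ofReal hf (ae_of_all _ h0), h1, ENNReal.ofReal_one]

instance instIsProbabilityMeasureMlMeasure (θ : MLParam n p) :
    IsProbabilityMeasure (mlMeasure h θ) :=
  isProbabilityMeasure_withDensity_ofReal
    (integrable_of_continuous_of_compactSpace (continuous_mlDensity_right h θ))
    (fun X => (mlDensity_pos h θ X).le) (integral_mlDensity h θ)

lemma continuous_mixDensity :
    Continuous fun q : MixParam n p C × Stiefel n p => mixDensity h q.1 q.2 := by
  unfold mixDensity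
  refine continuous_finsetSum _ fun c _ => Continuous.mul (by fun_prop) ?_
  exact (continuous_mlDensity h).comp
    (f := fun q : MixParam n p C × Stiefel n p => (q.1.1 c, q.2)) (by fun_prop)

lemma continuous_mixDensity_right (ξ : MixParam n p C) : Continuous (mixDensity h ξ) :=
  Continuous.comp (g := fun q : MixParam n p C × Stiefel n p => mixDensity h q.1 q.2)
    (f := fun X => (ξ, X)) (continuous_mixDensity h) (by fun_prop)

lemma integrable_mixDensity (ξ : MixParam n p C) {μ : Measure (Stiefel n p)}
    [IsFiniteMeasure μ] : Integrable (mixDensity h ξ) μ :=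
  integrable_of_continuous_of_compactSpace (continuous_mixDensity_right h ξ)

lemma openSimplex_nonempty_index {w : Fin C → ℝ} (hw : w ∈ openSimplex C) :
    Nonempty (Fin C) := by
  by_contra hC
  rw [not_nonempty_iff] at hC
  simpa using hw.2

lemma mixDensity_pos {ξ : MixParam n p C} (hξ : ξ.2 ∈ openSimplex C) (X : Stiefel n p) :
    0 < mixDensity h ξ X := by
  have := openSimplex_nonempty_index hξ
  exact Finset.sum_pos (fun c _ => mul_pos (hξ.1 c) (mlDensity_pos h _ X)) Finset.univ_nonempty

lemma integral_mixDensity {ξ : MixParam n p C} (hξ : ξ.2 ∈ openSimplex C) :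
    ∫ X, mixDensity h ξ X ∂(stiefelHaar h) = 1 := by
  unfold mixDensity
  rw [integral_finsetSum]
  · simp_rw [integral_const_mul, integral_mlDensity, mul_one]
    exact hξ.2
  · exact fun c _ => (integrable_of_continuous_of_compactSpace
      (continuous_mlDensity_right h _)).const_mul _

lemma isProbabilityMeasure_mixMeasure {ξ : MixParam n p C} (hξ : ξ.2 ∈ openSimplex C) :
    IsProbabilityMeasure (mixMeasure h ξ) :=
  isProbabilityMeasure_withDensity_ofReal (integrable_mixDensity h ξ)
    (fun X => (mixDensity_pos h hξ X).le) (integral_mixDensity h hξ)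

/-- The probability of `A` under the mixture, as a real number. -/
def mixProb (A : Set (Stiefel n p)) (ξ : MixParam n p C) : ℝ :=
  ∫ X in A, mixDensity h ξ X ∂(stiefelHaar h)

lemma continuous_mixProb (A : Set (Stiefel n p)) :
    Continuous (mixProb h A : MixParam n p C → ℝ) :=
  continuous_integral_of_compactSpace (continuous_mixDensity h)

lemma mixProb_compl {A : Set (Stiefel n p)} (hA : MeasurableSet A) {ξ : MixParam n p C}
    (hξ : ξ.2 ∈ openSimplex C) : mixProb h Aᶜ ξ = 1 - mixProb h A ξ := by
  have := integral_add_compl hA (integrable_mixDensity h ξ (μ := stiefelHaar h))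
  rw [integral_mixDensity h hξ] at this
  unfold mixProb
  linarith

lemma mixProb_mem_Icc {A : Set (Stiefel n p)} (hA : MeasurableSet A) {ξ : MixParam n p C}
    (hξ : ξ.2 ∈ openSimplex C) : mixProb h A ξ ∈ Set.Icc (0 : ℝ) 1 := by
  have h1 : ∀ B, 0 ≤ mixProb h B ξ := fun B =>
    integral_nonneg fun X => (mixDensity_pos h hξ X).le
  have h2 := h1 Aᶜ
  rw [mixProb_compl h hA hξ] at h2
  exact ⟨h1 A, by linarith⟩

lemma integral_mixMeasure {ξ : MixParam n p C} (hξ : ξ.2 ∈ openSimplex C)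
    (g : Stiefel n p → ℝ) :
    ∫ X, g X ∂(mixMeasure h ξ) = ∫ X, mixDensity h ξ X * g X ∂(stiefelHaar h) := by
  unfold mixMeasure
  rw [integral_withDensity_eq_integral_toReal_smul]
  · refine integral_congr_ae (ae_of_all _ fun X => ?_)
    simp [ENNReal.toReal_ofReal (mixDensity_pos h hξ X).le]
  · exact (continuous_mixDensity_right h ξ).measurable.ennreal_ofReal
  · exact ae_of_all _ fun X => ENNReal.ofReal_lt_top

lemma lintegral_mixMeasure (ξ : MixParam n p C) {g : Stiefel n p → ENNReal}
    (hg : Measurable g) :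
    ∫⁻ X, g X ∂(mixMeasure h ξ) =
      ∫⁻ X, ENNReal.ofReal (mixDensity h ξ X) * g X ∂(stiefelHaar h) :=
  lintegral_withDensity_eq_lintegral_mul _
    (continuous_mixDensity_right h ξ).measurable.ennreal_ofReal hg

end Density

/-! ### The Dirichlet integral is finite -/

section Dirichlet

lemma lintegral_beta_lt_top {a b : ℝ} (ha : 0 < a) (hb : 0 < b) :
    ∫⁻ u in Set.Ioo (0 : ℝ) 1, ENNReal.ofReal (u ^ (a - 1) * (1 - u) ^ (b - 1)) < ⊤ := by
  have h1 := lintegral_betaPDF_eq_one ha hb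
  have hB : 0 < 1 / beta a b := one_div_pos.2 (beta_pos ha hb)
  have h2 : ∀ u : ℝ, ENNReal.ofReal (1 / beta a b * u ^ (a - 1) * (1 - u) ^ (b - 1)) =
      ENNReal.ofReal (1 / beta a b) * ENNReal.ofReal (u ^ (a - 1) * (1 - u) ^ (b - 1)) :=
    fun u => by rw [mul_assoc, ENNReal.ofReal_mul hB.le]
  rw [lintegral_betaPDF] at h1
  simp_rw [h2] at h1
  rw [lintegral_const_mul' _ _ ENNReal.ofReal_ne_top] at h1
  by_contra htop
  rw [not_lt, top_le_iff] at htop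
  rw [htop, ENNReal.mul_top (ENNReal.ofReal_pos.2 hB).ne'] at h1
  exact ENNReal.top_ne_one h1

/-- Substitution `y = s u`; the exponent `a + b - 1` collects `a - 1`, `b - 1` and the Jacobian. -/
lemma lintegral_beta_scaled {a b s : ℝ} (hs : 0 < s) :
    ∫⁻ y in Set.Ioo (0 : ℝ) s, ENNReal.ofReal (y ^ (a - 1) * (s - y) ^ (b - 1)) =
      ENNReal.ofReal (s ^ (a + b - 1)) *
        ∫⁻ u in Set.Ioo (0 : ℝ) 1, ENNReal.ofReal (u ^ (a - 1) * (1 - u) ^ (b - 1)) := by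
  have himg : Set.Ioo (0 : ℝ) s = (fun u => s * u) '' Set.Ioo (0 : ℝ) 1 := by
    rw [Set.image_mul_left_Ioo hs]; simp
  rw [himg, lintegral_image_eq_lintegral_abs_deriv_mul measurableSet_Ioo (f' := fun _ => s)
    (fun x _ => by simpa using ((hasDerivAt_id x).const_mul s).hasDerivWithinAt)
    (mul_right_injective₀ hs.ne').injOn, ← lintegral_const_mul' _ _ ENNReal.ofReal_ne_top]
  refine setLIntegral_congr_fun measurableSet_Ioo fun u hu => ?_
  have h1 : s - s * u = s * (1 - u) := by ring
  rw [abs_of_pos hs, h1, Real.mul_rpow hs.le hu.1.le, Real.mul_rpow hs.le (by linarith [hu.2]),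
    ← ENNReal.ofReal_mul hs.le, ← ENNReal.ofReal_mul (Real.rpow_nonneg hs.le _)]
  congr 1
  have h2 : s ^ (a + b - 1) = s * s ^ (a - 1) * s ^ (b - 1) := by
    nth_rewrite 2 [← Real.rpow_one s]
    rw [← Real.rpow_add hs, ← Real.rpow_add hs]
    congr 1
    ring
  rw [h2]
  ring

/-- The open simplex in the first `m` coordinates. -/
def cornerSimplex (m : ℕ) : Set (Fin m → ℝ) := {x | (∀ i, 0 < x i) ∧ ∑ i, x i < 1}

lemma isOpen_cornerSimplex (m : ℕ) : IsOpen (cornerSimplex m) := by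
  have : cornerSimplex m = (⋂ i, {x : Fin m → ℝ | 0 < x i}) ∩ {x | ∑ i, x i < 1} := by
    ext x; simp [cornerSimplex]
  rw [this]
  exact (isOpen_iInter_of_finite fun i => isOpen_lt continuous_const (continuous_apply i)).inter
    (isOpen_lt (continuous_finsetSum _ fun i _ => continuous_apply i) continuous_const)

lemma cons_mem_cornerSimplex {m : ℕ} (y : ℝ) (x : Fin m → ℝ) :
    (Fin.cons y x : Fin (m + 1) → ℝ) ∈ cornerSimplex (m + 1) ↔
      x ∈ cornerSimplex m ∧ y ∈ Set.Ioo 0 (1 - ∑ i, x i) := by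
  simp only [cornerSimplex, Set.mem_ofPred_eq, Fin.forall_fin_succ, Fin.cons_zero, Fin.cons_succ,
    Fin.sum_univ_succ, Set.mem_Ioo]
  constructor
  · rintro ⟨⟨h0, h1⟩, h2⟩
    exact ⟨⟨h1, by linarith⟩, h0, by linarith⟩
  · rintro ⟨⟨h1, _⟩, h0, h2⟩
    exact ⟨⟨h0, h1⟩, by linarith⟩

/-- The unnormalized Dirichlet density on the corner simplex. -/
def cornerDirichlet {m : ℕ} (a : Fin m → ℝ) (b : ℝ) (x : Fin m → ℝ) : ENNReal :=
  ENNReal.ofReal ((∏ i, x i ^ (a i - 1)) * (1 - ∑ i, x i) ^ (b - 1))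

lemma measurable_cornerDirichlet {m : ℕ} (a : Fin m → ℝ) (b : ℝ) :
    Measurable (cornerDirichlet a b) := by
  unfold cornerDirichlet
  fun_prop

/-- Integrating out the first coordinate over `(0, 1 - ∑ x_i)` leaves a beta integral times `(1 - ∑
x_i) ^ (a 0 + b - 1)`. What remains is a Dirichlet density in one variable fewer, with last
parameter `a 0 + b`; this is why the induction must quantify over `b`. -/
theorem lintegral_cornerDirichlet_lt_top (m : ℕ) : ∀ (a : Fin m → ℝ) (b : ℝ), (∀ i, 0 < a i) →
    0 < b → ∫⁻ x in cornerSimplex m, cornerDirichlet a b x < ⊤ := by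
  induction m with
  | zero =>
    intro a b _ _
    refine (setLIntegral_le_lintegral _ _).trans_lt ?_
    simp [cornerDirichlet, lintegral_unique, volume_pi]
  | succ m ih =>
    intro a b ha hb
    have hmp := (volume_preserving_piFinSuccAbove (fun _ : Fin (m + 1) => ℝ) 0).symm
    have hsymm : ∀ q : ℝ × (Fin m → ℝ),
        (MeasurableEquiv.piFinSuccAbove (fun _ : Fin (m + 1) => ℝ) 0).symm q =
          (Fin.cons q.1 q.2 : Fin (m + 1) → ℝ) := by
      intro q
      exact Fin.insertNth_zero' _ _
    have hmeas : Measurable ((cornerSimplex (m + 1)).indicator (cornerDirichlet a b)) :=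
      (measurable_cornerDirichlet a b).indicator (isOpen_cornerSimplex _).measurableSet
    rw [← lintegral_indicator (isOpen_cornerSimplex _).measurableSet, ← hmp.lintegral_comp hmeas]
    simp_rw [hsymm]
    have hcons : Measurable fun q : ℝ × (Fin m → ℝ) => (Fin.cons q.1 q.2 : Fin (m + 1) → ℝ) := by
      simp_rw [← hsymm]
      exact hmp.measurable
    rw [Measure.volume_eq_prod, lintegral_prod_symm
      (fun q : ℝ × (Fin m → ℝ) => (cornerSimplex (m + 1)).indicator (cornerDirichlet a b)
        (Fin.cons q.1 q.2 : Fin (m + 1) → ℝ)) (hmeas.comp hcons).aemeasurable]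
    set K := ∫⁻ u in Set.Ioo (0 : ℝ) 1, ENNReal.ofReal (u ^ (a 0 - 1) * (1 - u) ^ (b - 1)) with hK
    have hKtop : K < ⊤ := lintegral_beta_lt_top (ha 0) hb
    have hinner : ∀ x : Fin m → ℝ,
        ∫⁻ y, (cornerSimplex (m + 1)).indicator (cornerDirichlet a b)
          (Fin.cons y x : Fin (m + 1) → ℝ) =
        (cornerSimplex m).indicator
          (fun x => cornerDirichlet (fun i => a i.succ) (a 0 + b) x * K) x := by
      intro x
      by_cases hx : x ∈ cornerSimplex m
      · have hs : 0 < 1 - ∑ i, x i := by linarith [hx.2]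
        have hpr : 0 ≤ ∏ i, x i ^ (a i.succ - 1) :=
          Finset.prod_nonneg fun i _ => Real.rpow_nonneg (hx.1 i).le _
        rw [Set.indicator_of_mem hx]
        calc ∫⁻ y, (cornerSimplex (m + 1)).indicator (cornerDirichlet a b)
              (Fin.cons y x : Fin (m + 1) → ℝ)
            = ∫⁻ y, (Set.Ioo 0 (1 - ∑ i, x i)).indicator (fun y =>
                ENNReal.ofReal (∏ i, x i ^ (a i.succ - 1)) *
                ENNReal.ofReal (y ^ (a 0 - 1) * ((1 - ∑ i, x i) - y) ^ (b - 1))) y := by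
              refine lintegral_congr fun y => ?_
              simp only [Set.indicator, cons_mem_cornerSimplex, hx, true_and]
              split_ifs with hy
              · rw [← ENNReal.ofReal_mul hpr, cornerDirichlet]
                congr 1
                simp only [Fin.prod_univ_succ, Fin.sum_univ_succ, Fin.cons_zero, Fin.cons_succ]
                rw [show 1 - (y + ∑ i, x i) = 1 - ∑ i, x i - y by ring]
                ring
              · rfl
          _ = cornerDirichlet (fun i => a i.succ) (a 0 + b) x * K := by
              rw [lintegral_indicator measurableSet_Ioo,
                lintegral_const_mul' _ _ ENNReal.ofReal_ne_top, lintegral_beta_scaled hs, hK,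
                cornerDirichlet, ENNReal.ofReal_mul hpr, mul_assoc]
      · rw [Set.indicator_of_notMem hx]
        have : ∀ y, (cornerSimplex (m + 1)).indicator (cornerDirichlet a b)
            (Fin.cons y x : Fin (m + 1) → ℝ) = 0 := fun y =>
          Set.indicator_of_notMem (fun hy => hx ((cons_mem_cornerSimplex y x).1 hy).1) _
        simp [this]
    simp_rw [hinner]
    rw [lintegral_indicator (isOpen_cornerSimplex _).measurableSet,
      lintegral_mul_const' _ _ hKtop.ne]
    exact ENNReal.mul_lt_top (ih _ _ (fun i => ha _) (add_pos (ha 0) hb)) hKtop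

end Dirichlet

/-! ### Supports of measures -/

section Support

variable {α β : Type*} [MeasurableSpace α] [MeasurableSpace β]

lemma mem_support_prod [TopologicalSpace α] [TopologicalSpace β] {μ : Measure α} {ν : Measure β}
    [SFinite ν] {x : α} {y : β} (hx : x ∈ μ.support) (hy : y ∈ ν.support) :
    (x, y) ∈ (μ.prod ν).support := by
  rw [Measure.mem_support_iff_forall] at *
  intro U hU
  obtain ⟨u, hu, v, hv, huv⟩ := mem_nhds_prod_iff.1 hU
  refine lt_of_lt_of_le ?_ (measure_mono huv)
  rw [Measure.prod_prod]
  exact ENNReal.mul_pos (hx u hu).ne' (hy v hv).ne'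

lemma mem_support_pi {ι : Type*} [Fintype ι] {X : ι → Type*} [∀ i, MeasurableSpace (X i)]
    [∀ i, TopologicalSpace (X i)] {μ : ∀ i, Measure (X i)} [∀ i, SigmaFinite (μ i)]
    {x : ∀ i, X i} (hx : ∀ i, x i ∈ (μ i).support) : x ∈ (Measure.pi μ).support := by
  simp_rw [Measure.mem_support_iff_forall] at *
  intro U hU
  rw [nhds_pi, Filter.mem_pi'] at hU
  obtain ⟨I, t, ht, htU⟩ := hU
  have hsub : Set.univ.pi t ⊆ U := fun y hy => htU fun i _ => hy i trivial
  refine lt_of_lt_of_le ?_ (measure_mono hsub)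
  rw [Measure.pi_pi]
  exact pos_iff_ne_zero.2 (Finset.prod_ne_zero_iff.2 fun i _ => (hx i (t i) (ht i)).ne')

lemma mem_support_map [TopologicalSpace α] [TopologicalSpace β] [OpensMeasurableSpace β]
    {μ : Measure α} {f : α → β} (hf : Continuous f) (hm : Measurable f) {x : α}
    (hx : x ∈ μ.support) : f x ∈ (μ.map f).support := by
  rw [Measure.mem_support_iff_forall] at *
  intro U hU
  obtain ⟨W, hWU, hW, hxW⟩ := mem_nhds_iff.1 hU
  refine lt_of_lt_of_le ?_ (measure_mono hWU)
  rw [Measure.map_apply hm hW.measurableSet]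
  exact hx _ ((hW.preimage hf).mem_nhds hxW)

lemma mem_support_restrict_of_isOpen [TopologicalSpace α] [OpensMeasurableSpace α]
    {μ : Measure α} {s : Set α} (hs : IsOpen s) {x : α} (hxs : x ∈ s) (hx : x ∈ μ.support) :
    x ∈ (μ.restrict s).support :=
  (Measure.interior_inter_support) ⟨by rwa [hs.interior_eq], hx⟩

/-- The density need only be nonzero near `x`. This local form is what the Dirichlet factor needs,
whose density is controlled only where all coordinates are positive. -/
lemma mem_support_withDensity [TopologicalSpace α] [OpensMeasurableSpace α]
    {μ : Measure α} {f : α → ENNReal} (hf : Measurable f) {x : α} {V : Set α} (hV : V ∈ 𝓝 x)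
    (hpos : ∀ y ∈ V, f y ≠ 0) (hx : x ∈ μ.support) : x ∈ (μ.withDensity f).support := by
  rw [Measure.mem_support_iff_forall] at *
  intro U hU
  obtain ⟨W, hWU, hW, hxW⟩ := mem_nhds_iff.1 (inter_mem hU hV)
  refine lt_of_lt_of_le ?_ (measure_mono (hWU.trans Set.inter_subset_left))
  rw [withDensity_apply _ hW.measurableSet, setLIntegral_pos_iff hf]
  have : Function.support f ∩ W = W :=
    Set.inter_eq_right.2 fun y hy => hpos y (hWU hy).2
  rw [this]
  exact hx W (hW.mem_nhds hxW)

lemma mem_support_smul [TopologicalSpace α] {μ : Measure α} {r : ENNReal} (hr : r ≠ 0) {x : α}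
    (hx : x ∈ μ.support) : x ∈ (r • μ).support := by
  rw [Measure.mem_support_iff_forall] at *
  intro U hU
  rw [Measure.smul_apply, smul_eq_mul]
  exact ENNReal.mul_pos hr (hx U hU).ne'

lemma isProbabilityMeasure_normalizeMeasure {μ : Measure α} (h0 : μ Set.univ ≠ 0)
    (h1 : μ Set.univ ≠ ⊤) : IsProbabilityMeasure (normalizeMeasure μ) :=
  ⟨by rw [normalizeMeasure, Measure.smul_apply, smul_eq_mul, ENNReal.inv_mul_cancel h0 h1]⟩

lemma isProbabilityMeasure_normalizeMeasure_of_mem_support [TopologicalSpace α] {μ : Measure α}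
    {x : α} (hx : x ∈ μ.support) (h1 : μ Set.univ ≠ ⊤) :
    IsProbabilityMeasure (normalizeMeasure μ) :=
  isProbabilityMeasure_normalizeMeasure
    ((Measure.mem_support_iff_forall x).1 hx _ univ_mem).ne' h1

lemma mem_support_normalizeMeasure [TopologicalSpace α] {μ : Measure α} (h1 : μ Set.univ ≠ ⊤)
    {x : α} (hx : x ∈ μ.support) : x ∈ (normalizeMeasure μ).support :=
  mem_support_smul (ENNReal.inv_ne_zero.2 h1) hx

end Support

/-! ### The prior -/

section Prior

variable {n p C : ℕ} (h : p ≤ n)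

lemma isOpen_firstRowPos (n p : ℕ) : IsOpen (firstRowPos n p) := by
  simp only [firstRowPos, Set.ofPred_forall]
  exact isOpen_iInter_of_finite fun i => isOpen_iInter_of_finite fun j =>
    isOpen_iInter_of_finite fun _ => isOpen_lt continuous_const (continuous_apply_stiefel i j)

lemma isOpen_posOrthant (p : ℕ) : IsOpen (posOrthant p) := by
  simp only [posOrthant, Set.ofPred_forall]
  exact isOpen_iInter_of_finite fun j => isOpen_lt continuous_const (continuous_apply j)

lemma isOpen_decreasingPos (p : ℕ) : IsOpen (decreasingPos p) := by
  have h1 : decreasingPos p = posOrthant p ∩ ⋂ i, ⋂ j, ⋂ _ : i < j, {d | d j < d i} := by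
    ext d
    simp only [decreasingPos, posOrthant, StrictAnti, Set.mem_inter_iff, Set.mem_iInter,
      Set.mem_ofPred_eq]
  rw [h1]
  exact (isOpen_posOrthant p).inter (isOpen_iInter_of_finite fun i =>
    isOpen_iInter_of_finite fun j => isOpen_iInter_of_finite fun _ =>
      isOpen_lt (continuous_apply j) (continuous_apply i))

lemma measurableSet_openSimplex (C : ℕ) : MeasurableSet (openSimplex C) := by
  have h1 : openSimplex C = posOrthant C ∩ {w | ∑ c, w c = 1} := rfl
  rw [h1]
  exact (isOpen_posOrthant C).measurableSet.inter
    (measurableSet_eq_fun (by fun_prop) measurable_const)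

/-- The constraints on the `(M_c, d_c)` that define the parameter space. -/
def componentConstraint (n p C : ℕ) : Set (MixParam n p C) :=
  {ξ | ∀ c, (ξ.1 c).1 ∈ firstRowPos n p ∧ (ξ.1 c).2.1 ∈ decreasingPos p}

lemma isOpen_componentConstraint (n p C : ℕ) : IsOpen (componentConstraint n p C) := by
  simp only [componentConstraint, Set.ofPred_forall]
  refine isOpen_iInter_of_finite fun c => ?_
  exact ((isOpen_firstRowPos n p).preimage (by fun_prop :
      Continuous fun ξ : MixParam n p C => (ξ.1 c).1)).inter
    ((isOpen_decreasingPos p).preimage (by fun_prop :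
      Continuous fun ξ : MixParam n p C => (ξ.1 c).2.1))

lemma paramSpace_eq (n p C : ℕ) :
    paramSpace n p C = componentConstraint n p C ∩ Prod.snd ⁻¹' openSimplex C := rfl

lemma measurableSet_paramSpace (n p C : ℕ) : MeasurableSet (paramSpace n p C) := by
  rw [paramSpace_eq]
  exact (isOpen_componentConstraint n p C).measurableSet.inter
    (measurable_snd (measurableSet_openSimplex C))

/-! #### The IMDY factor -/

lemma measurable_imdyDensity (ν : ℝ) (η : Fin p → ℝ) : Measurable (imdyDensity h ν η) := by
  unfold imdyDensity
  have := (continuous_hyp0F1 h).measurable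
  fun_prop

lemma imdyDensity_pos (ν : ℝ) (η d : Fin p → ℝ) : 0 < imdyDensity h ν η d :=
  div_pos (Real.exp_pos _) (Real.rpow_pos_of_pos (hyp0F1_pos h d) _)

lemma mem_support_imdy_unnormalized (ν : ℝ) (η : Fin p → ℝ) {d : Fin p → ℝ}
    (hd : d ∈ posOrthant p) :
    d ∈ ((volume.restrict (posOrthant p)).withDensity
      fun d => ENNReal.ofReal (imdyDensity h ν η d)).support := by
  refine mem_support_withDensity (measurable_imdyDensity h ν η).ennreal_ofReal univ_mem
    (fun y _ => (ENNReal.ofReal_pos.2 (imdyDensity_pos h ν η y)).ne')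
    (mem_support_restrict_of_isOpen (isOpen_posOrthant p) hd ?_)
  rw [Measure.support_eq_univ]
  trivial

lemma imdy_unnormalized_univ_ne_top {ν : ℝ} {η : Fin p → ℝ}
    (hη : IntegrableOn (imdyDensity h ν η) (posOrthant p) volume) :
    ((volume.restrict (posOrthant p)).withDensity
      fun d => ENNReal.ofReal (imdyDensity h ν η d)) Set.univ ≠ ⊤ := by
  rw [withDensity_apply _ MeasurableSet.univ, Measure.restrict_univ]
  exact hη.lintegral_lt_top.ne

lemma isProbabilityMeasure_imdyMeasure {ν : ℝ} {η : Fin p → ℝ}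
    (hη : IntegrableOn (imdyDensity h ν η) (posOrthant p) volume) :
    IsProbabilityMeasure (imdyMeasure h ν η) :=
  isProbabilityMeasure_normalizeMeasure_of_mem_support
    (mem_support_imdy_unnormalized h ν η (d := fun _ => 1) fun _ => one_pos)
    (imdy_unnormalized_univ_ne_top h hη)

lemma mem_support_imdyMeasure {ν : ℝ} {η : Fin p → ℝ}
    (hη : IntegrableOn (imdyDensity h ν η) (posOrthant p) volume) {d : Fin p → ℝ}
    (hd : d ∈ posOrthant p) : d ∈ (imdyMeasure h ν η).support :=
  mem_support_normalizeMeasure (imdy_unnormalized_univ_ne_top h hη)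
    (mem_support_imdy_unnormalized h ν η hd)

/-! #### The matrix Langevin factors -/

lemma mem_support_mlMeasure (θ : MLParam n p) (M : Stiefel n p) :
    M ∈ (mlMeasure h θ).support := by
  refine mem_support_withDensity
    (continuous_mlDensity_right h θ).measurable.ennreal_ofReal univ_mem
    (fun X _ => (ENNReal.ofReal_pos.2 (mlDensity_pos h θ X)).ne') ?_
  rw [Measure.support_eq_univ]
  trivial

/-! #### The Dirichlet factor -/

/-- The probability vector with prescribed first `C - 1` coordinates. -/
def simplexMap (C : ℕ) (x : Fin (C - 1) → ℝ) (c : Fin C) : ℝ :=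
  if hc : c.val < C - 1 then x ⟨c.val, hc⟩ else 1 - ∑ i, x i

lemma simplexVolume_eq (C : ℕ) :
    simplexVolume C = (volume.restrict (cornerSimplex (C - 1))).map (simplexMap C) := rfl

lemma continuous_simplexMap (C : ℕ) : Continuous (simplexMap C) := by
  refine continuous_pi fun c => ?_
  unfold simplexMap
  split_ifs
  · fun_prop
  · fun_prop

lemma simplexMap_castSucc {m : ℕ} (x : Fin m → ℝ) (i : Fin m) :
    simplexMap (m + 1) x i.castSucc = x i := by
  simp [simplexMap]

lemma simplexMap_last {m : ℕ} (x : Fin m → ℝ) :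
    simplexMap (m + 1) x (Fin.last m) = 1 - ∑ i, x i := by
  simp [simplexMap]

lemma simplexMap_mem_openSimplex {m : ℕ} {x : Fin m → ℝ} (hx : x ∈ cornerSimplex m) :
    simplexMap (m + 1) x ∈ openSimplex (m + 1) := by
  refine ⟨fun c => ?_, ?_⟩
  · refine Fin.lastCases ?_ (fun i => ?_) c
    · rw [simplexMap_last]; linarith [hx.2]
    · rw [simplexMap_castSucc]; exact hx.1 i
  · rw [Fin.sum_univ_castSucc, simplexMap_last]
    simp_rw [simplexMap_castSucc]
    ring

lemma ae_mem_openSimplex_simplexVolume {m : ℕ} :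
    ∀ᵐ w ∂(simplexVolume (m + 1)), w ∈ openSimplex (m + 1) := by
  rw [simplexVolume_eq, ae_map_iff (p := fun w => w ∈ openSimplex (m + 1))
    (continuous_simplexMap _).measurable.aemeasurable (measurableSet_openSimplex _)]
  exact (ae_restrict_mem (isOpen_cornerSimplex _).measurableSet).mono fun x hx =>
    simplexMap_mem_openSimplex hx

lemma mem_support_simplexVolume {m : ℕ} {w : Fin (m + 1) → ℝ} (hw : w ∈ openSimplex (m + 1)) :
    w ∈ (simplexVolume (m + 1)).support := by
  have hsum := hw.2
  rw [Fin.sum_univ_castSucc] at hsum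
  have hx : (fun i : Fin m => w i.castSucc) ∈ cornerSimplex m :=
    ⟨fun i => hw.1 _, by linarith [hw.1 (Fin.last m)]⟩
  -- The last coordinate is recovered from the others because the total is one.
  have hw' : w = simplexMap (m + 1) (fun i : Fin m => w i.castSucc) := by
    funext c
    refine Fin.lastCases ?_ (fun i => ?_) c
    · rw [simplexMap_last]; linarith
    · rw [simplexMap_castSucc]
  rw [hw', simplexVolume_eq]
  refine mem_support_map (continuous_simplexMap _) (continuous_simplexMap _).measurable
    (mem_support_restrict_of_isOpen (isOpen_cornerSimplex _) hx ?_)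
  rw [Measure.support_eq_univ]
  trivial

lemma measurable_dirichletDensity (α : Fin C → ℝ) :
    Measurable fun w : Fin C → ℝ => ENNReal.ofReal (∏ c, w c ^ (α c - 1)) := by
  fun_prop

lemma dirichlet_unnormalized_univ_ne_top {m : ℕ} {α : Fin (m + 1) → ℝ} (hα : ∀ c, 0 < α c) :
    ((simplexVolume (m + 1)).withDensity
      fun w => ENNReal.ofReal (∏ c, w c ^ (α c - 1))) Set.univ ≠ ⊤ := by
  rw [withDensity_apply _ MeasurableSet.univ, Measure.restrict_univ, simplexVolume_eq,
    lintegral_map (measurable_dirichletDensity α) (continuous_simplexMap _).measurable]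
  have key := lintegral_cornerDirichlet_lt_top m (fun i => α i.castSucc) (α (Fin.last m))
    (fun i => hα _) (hα _)
  refine ne_of_lt (lt_of_le_of_lt (le_of_eq ?_) key)
  refine lintegral_congr fun x => ?_
  rw [Fin.prod_univ_castSucc, simplexMap_last]
  simp_rw [simplexMap_castSucc]
  rfl

lemma mem_support_dirichlet_unnormalized {m : ℕ} (α : Fin (m + 1) → ℝ) {w : Fin (m + 1) → ℝ}
    (hw : w ∈ openSimplex (m + 1)) :
    w ∈ ((simplexVolume (m + 1)).withDensity
      fun w => ENNReal.ofReal (∏ c, w c ^ (α c - 1))).support := by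
  refine mem_support_withDensity (measurable_dirichletDensity α)
    ((isOpen_posOrthant _).mem_nhds hw.1) (fun y hy => ?_) (mem_support_simplexVolume hw)
  exact (ENNReal.ofReal_pos.2 (Finset.prod_pos fun c _ => Real.rpow_pos_of_pos (hy c) _)).ne'

lemma isProbabilityMeasure_dirichletMeasure {α : Fin C → ℝ} (hα : ∀ c, 0 < α c)
    {w : Fin C → ℝ} (hw : w ∈ openSimplex C) : IsProbabilityMeasure (dirichletMeasure α) := by
  obtain ⟨c⟩ := openSimplex_nonempty_index hw
  -- A point of the open simplex forces `C ≥ 1`, so that there is a last coordinate to eliminate.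
  obtain ⟨m, rfl⟩ : ∃ m, C = m + 1 := ⟨C - 1, by have := c.pos; omega⟩
  exact isProbabilityMeasure_normalizeMeasure_of_mem_support
    (mem_support_dirichlet_unnormalized α hw) (dirichlet_unnormalized_univ_ne_top hα)

lemma mem_support_dirichletMeasure {α : Fin C → ℝ} (hα : ∀ c, 0 < α c)
    {w : Fin C → ℝ} (hw : w ∈ openSimplex C) : w ∈ (dirichletMeasure α).support := by
  obtain ⟨c⟩ := openSimplex_nonempty_index hw
  obtain ⟨m, rfl⟩ : ∃ m, C = m + 1 := ⟨C - 1, by have := c.pos; omega⟩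
  exact mem_support_normalizeMeasure (dirichlet_unnormalized_univ_ne_top hα)
    (mem_support_dirichlet_unnormalized α hw)

lemma ae_mem_openSimplex_dirichletMeasure (α : Fin C → ℝ)
    {w : Fin C → ℝ} (hw : w ∈ openSimplex C) :
    ∀ᵐ w ∂(dirichletMeasure α), w ∈ openSimplex C := by
  obtain ⟨c⟩ := openSimplex_nonempty_index hw
  obtain ⟨m, rfl⟩ : ∃ m, C = m + 1 := ⟨C - 1, by have := c.pos; omega⟩
  exact Measure.ae_smul_measure
    ((withDensity_absolutelyContinuous _ _).ae_le ae_mem_openSimplex_simplexVolume) _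

/-! #### The prior on the parameter space -/

lemma isFiniteMeasure_productPrior {H : Hyper n p C}
     (hη : ∀ c, IntegrableOn (imdyDensity h (H.ν c) (H.η c)) (posOrthant p) volume)
     (hα : ∀ c, 0 < H.α c) {ξ₀ : MixParam n p C} (hξ₀ : ξ₀ ∈ paramSpace n p C) : IsFiniteMeasure (productPrior h H) := by
  have h1 := fun c => isProbabilityMeasure_imdyMeasure h (hη c)
  have h2 := isProbabilityMeasure_dirichletMeasure hα hξ₀.2
  unfold productPrior
  infer_instance

lemma mem_support_productPrior {H : Hyper n p C}
     (hη : ∀ c, IntegrableOn (imdyDensity h (H.ν c) (H.η c)) (posOrthant p) volume)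
     (hα : ∀ c, 0 < H.α c) {ξ₀ : MixParam n p C} (hξ₀ : ξ₀ ∈ paramSpace n p C) : ξ₀ ∈ (productPrior h H).support := by
  have h1 := fun c => isProbabilityMeasure_imdyMeasure h (hη c)
  have h2 := isProbabilityMeasure_dirichletMeasure hα hξ₀.2
  refine mem_support_prod (x := ξ₀.1) (y := ξ₀.2) (mem_support_pi fun c => ?_)
    (mem_support_dirichletMeasure hα hξ₀.2)
  exact mem_support_prod (mem_support_mlMeasure h _ _)
    (mem_support_prod (mem_support_imdyMeasure h (hη c) (hξ₀.1 c).2.1)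
      (mem_support_mlMeasure le_rfl _ _))

/-- The parameter space is not a neighbourhood of `ξ₀`, because the simplex lies in a hyperplane.
Only the constraints on `(M_c, d_c)` are open; the simplex constraint holds almost surely under the
Dirichlet factor, so imposing it costs no mass. -/
lemma productPrior_inter_ne_zero {H : Hyper n p C}
     (hη : ∀ c, IntegrableOn (imdyDensity h (H.ν c) (H.η c)) (posOrthant p) volume)
     (hα : ∀ c, 0 < H.α c) {ξ₀ : MixParam n p C} (hξ₀ : ξ₀ ∈ paramSpace n p C)
    {U : Set (MixParam n p C)} (hU : U ∈ 𝓝 ξ₀) :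
    productPrior h H (paramSpace n p C ∩ U) ≠ 0 := by
  have h1 := fun c => isProbabilityMeasure_imdyMeasure h (hη c)
  have h2 := isProbabilityMeasure_dirichletMeasure hα hξ₀.2
  have hpos := (Measure.mem_support_iff_forall ξ₀).1 (mem_support_productPrior h hη hα hξ₀) _
    (inter_mem ((isOpen_componentConstraint n p C).mem_nhds hξ₀.1) hU)
  refine (hpos.trans_le (le_of_eq (measure_congr ?_))).ne'
  have hae : ∀ᵐ ξ ∂(productPrior h H), ξ.2 ∈ openSimplex C :=
    Measure.quasiMeasurePreserving_snd.ae (ae_mem_openSimplex_dirichletMeasure H.α hξ₀.2)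
  filter_upwards [hae] with ξ hξ
  refine propext ⟨fun hx => ⟨⟨hx.1, hξ⟩, hx.2⟩, fun hx => ⟨hx.1.1, hx.2⟩⟩

lemma isProbabilityMeasure_prior {H : Hyper n p C}
     (hη : ∀ c, IntegrableOn (imdyDensity h (H.ν c) (H.η c)) (posOrthant p) volume)
     (hα : ∀ c, 0 < H.α c) {ξ₀ : MixParam n p C} (hξ₀ : ξ₀ ∈ paramSpace n p C) : IsProbabilityMeasure (prior h H) := by
  have := isFiniteMeasure_productPrior h hη hα hξ₀
  have h0 := productPrior_inter_ne_zero h hη hα hξ₀ univ_mem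
  rw [Set.inter_univ] at h0
  exact cond_isProbabilityMeasure h0

lemma prior_ne_zero_of_mem_nhds {H : Hyper n p C}
     (hη : ∀ c, IntegrableOn (imdyDensity h (H.ν c) (H.η c)) (posOrthant p) volume)
     (hα : ∀ c, 0 < H.α c) {ξ₀ : MixParam n p C} (hξ₀ : ξ₀ ∈ paramSpace n p C)
    {U : Set (MixParam n p C)} (hU : U ∈ 𝓝 ξ₀) :
    prior h H (paramSpace n p C ∩ U) ≠ 0 := by
  have := isFiniteMeasure_productPrior h hη hα hξ₀
  rw [prior, cond_inter_self (measurableSet_paramSpace n p C),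
    cond_apply (measurableSet_paramSpace n p C)]
  exact mul_ne_zero (ENNReal.inv_ne_zero.2 (measure_ne_top _ _))
    (productPrior_inter_ne_zero h hη hα hξ₀ hU)

end Prior

/-! ### Evidence and posterior -/

section Posterior

variable {n p C : ℕ} (h : p ≤ n)

/-- For each `X` the strict inequality holds at `ξ₀`, by positivity and `s < 1`, hence nearby by
joint continuity; compactness of the manifold makes the neighbourhood uniform in `X`. -/
lemma eventually_forall_mul_mixDensity_le {ξ₀ : MixParam n p C} (hξ₀ : ξ₀.2 ∈ openSimplex C)
    {s : ℝ} (hs : s < 1) :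
    ∀ᶠ ξ in 𝓝 ξ₀, ∀ X, s * mixDensity h ξ₀ X ≤ mixDensity h ξ X := by
  have key := isCompact_univ.eventually_forall_of_forall_eventually (x₀ := ξ₀)
    (P := fun ξ X => s * mixDensity h ξ₀ X < mixDensity h ξ X) (K := Set.univ) fun X _ => by
      have hc : Continuous fun q : MixParam n p C × Stiefel n p => s * mixDensity h ξ₀ q.2 :=
        continuous_const.mul ((continuous_mixDensity_right h ξ₀).comp continuous_snd)
      refine (isOpen_lt hc (continuous_mixDensity h)).mem_nhds ?_
      exact mul_lt_of_lt_one_left (mixDensity_pos h hξ₀ X) hs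
  exact key.mono fun ξ hξ X => (hξ X trivial).le

/-- On the neighbourhood where `f_ξ ≥ s f_{ξ₀}`, every factor of the likelihood ratio is at least
`s`; `c` is the prior mass of that neighbourhood. The bound is deterministic in the data. -/
lemma exists_evidence_lower_bound {H : Hyper n p C}
    (hη : ∀ c, IntegrableOn (imdyDensity h (H.ν c) (H.η c)) (posOrthant p) volume)
    (hα : ∀ c, 0 < H.α c) {ξ₀ : MixParam n p C} (hξ₀ : ξ₀ ∈ paramSpace n p C)
    {s : ℝ} (hs0 : 0 < s) (hs : s < 1) :
    ∃ c : ENNReal, c ≠ 0 ∧ c ≠ ⊤ ∧ ∀ (x : ℕ → Stiefel n p) (N : ℕ),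
      ENNReal.ofReal s ^ N * c ≤ evidence h H ξ₀ x N (paramSpace n p C) := by
  have := isProbabilityMeasure_prior h hη hα hξ₀
  obtain ⟨U, hU, hUo, hξU⟩ := mem_nhds_iff.1 (eventually_forall_mul_mixDensity_le h hξ₀.2 hs)
  refine ⟨prior h H (paramSpace n p C ∩ U),
    prior_ne_zero_of_mem_nhds h hη hα hξ₀ (hUo.mem_nhds hξU), measure_ne_top _ _, fun x N => ?_⟩
  have hm : MeasurableSet (paramSpace n p C ∩ U) :=
    (measurableSet_paramSpace n p C).inter hUo.measurableSet
  rw [← setLIntegral_const]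
  refine (setLIntegral_mono' hm fun ξ hξ => ?_).trans (lintegral_mono_set Set.inter_subset_left)
  rw [← ENNReal.ofReal_pow hs0.le]
  refine ENNReal.ofReal_le_ofReal ?_
  rw [likelihoodRatio, ← Finset.card_range N, ← Finset.prod_const, Finset.card_range]
  refine Finset.prod_le_prod (fun _ _ => hs0.le) fun i _ => ?_
  rw [le_div_iff₀ (mixDensity_pos h hξ₀.2 _)]
  exact hU hξ.2 _

/-! ### Expected evidence under the true law -/

/-- The likelihood ratio of one observation, weighted by `g`. -/
def weightedRatio (ξ₀ : MixParam n p C) (g : Stiefel n p → ENNReal) (ξ : MixParam n p C)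
    (X : Stiefel n p) : ENNReal :=
  ENNReal.ofReal (mixDensity h ξ X / mixDensity h ξ₀ X) * g X

/-- The evidence of `S` with every observation weighted by `g`. -/
def weightedEvidence (H : Hyper n p C) (ξ₀ : MixParam n p C) (g : Stiefel n p → ENNReal)
    (x : ℕ → Stiefel n p) (N : ℕ) (S : Set (MixParam n p C)) : ENNReal :=
  ∫⁻ ξ in S, ∏ i ∈ Finset.range N, weightedRatio h ξ₀ g ξ (x i) ∂(prior h H)

lemma measurable_weightedRatio (ξ₀ : MixParam n p C) {g : Stiefel n p → ENNReal}
    (hg : Measurable g) :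
    Measurable fun q : MixParam n p C × Stiefel n p => weightedRatio h ξ₀ g q.1 q.2 := by
  unfold weightedRatio
  have h1 := (continuous_mixDensity h (C := C)).measurable
  have h2 : Measurable fun q : MixParam n p C × Stiefel n p => mixDensity h ξ₀ q.2 :=
    ((continuous_mixDensity_right h ξ₀).comp continuous_snd).measurable
  exact (h1.div h2).ennreal_ofReal.mul (hg.comp measurable_snd)

lemma measurable_weightedRatio_right (ξ₀ : MixParam n p C) {g : Stiefel n p → ENNReal}
    (hg : Measurable g) (ξ : MixParam n p C) : Measurable (weightedRatio h ξ₀ g ξ) := by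
  have h1 : Measurable fun X : Stiefel n p => (ξ, X) := by fun_prop
  exact Measurable.comp
    (g := fun q : MixParam n p C × Stiefel n p => weightedRatio h ξ₀ g q.1 q.2)
    (f := fun X : Stiefel n p => (ξ, X)) (measurable_weightedRatio h ξ₀ hg) h1

lemma measurable_prod_weightedRatio (ξ₀ : MixParam n p C) {g : Stiefel n p → ENNReal}
    (hg : Measurable g) (N : ℕ) :
    Measurable fun q : (ℕ → Stiefel n p) × MixParam n p C =>
      ∏ i ∈ Finset.range N, weightedRatio h ξ₀ g q.2 (q.1 i) := by
  refine Finset.measurable_fun_prod _ fun i _ => ?_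
  have h1 : Measurable fun q : (ℕ → Stiefel n p) × MixParam n p C => (q.2, q.1 i) := by fun_prop
  exact Measurable.comp
    (g := fun q : MixParam n p C × Stiefel n p => weightedRatio h ξ₀ g q.1 q.2)
    (f := fun q : (ℕ → Stiefel n p) × MixParam n p C => (q.2, q.1 i))
    (measurable_weightedRatio h ξ₀ hg) h1

/-- Averaging under `F_{ξ₀}` cancels the denominator of the ratio. -/
lemma lintegral_weightedRatio {ξ₀ : MixParam n p C} (hξ₀ : ξ₀.2 ∈ openSimplex C)
    {g : Stiefel n p → ENNReal} (hg : Measurable g) (ξ : MixParam n p C) :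
    ∫⁻ X, weightedRatio h ξ₀ g ξ X ∂(mixMeasure h ξ₀) =
      ∫⁻ X, ENNReal.ofReal (mixDensity h ξ X) * g X ∂(stiefelHaar h) := by
  rw [lintegral_mixMeasure h ξ₀ (measurable_weightedRatio_right h ξ₀ hg ξ)]
  refine lintegral_congr fun X => ?_
  have hpos := mixDensity_pos h hξ₀ X
  rw [weightedRatio, ← mul_assoc, ← ENNReal.ofReal_mul hpos.le, mul_div_cancel₀ _ hpos.ne']

lemma lintegral_prod_infinitePi {Ω : Type*} [MeasurableSpace Ω] (μ : Measure Ω)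
    [IsProbabilityMeasure μ] {G : Ω → ENNReal} (hG : Measurable G) (N : ℕ) :
    ∫⁻ x, ∏ i ∈ Finset.range N, G (x i) ∂(Measure.infinitePi fun _ : ℕ => μ) =
      (∫⁻ X, G X ∂μ) ^ N := by
  have hind := iIndepFun_infinitePi (P := fun _ : ℕ => μ) (X := fun _ => G) fun _ => hG
  rw [lintegral_prod_eq_prod_lintegral_of_indepFun _ (fun i (x : ℕ → Ω) => G (x i)) hind
    fun i => hG.comp (measurable_pi_apply i)]
  have : ∀ i, ∫⁻ x, G (x i) ∂(Measure.infinitePi fun _ : ℕ => μ) = ∫⁻ X, G X ∂μ := fun i =>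
    (measurePreserving_eval_infinitePi (fun _ : ℕ => μ) i).lintegral_comp hG
  simp [this]

/-- Tonelli, then independence of the observations: the expectation becomes a prior average of
`N`-th powers, so a uniform bound on one factor decays exponentially. -/
lemma lintegral_weightedEvidence (H : Hyper n p C) {ξ₀ : MixParam n p C}
    (hξ₀ : ξ₀.2 ∈ openSimplex C) {g : Stiefel n p → ENNReal} (hg : Measurable g) (N : ℕ)
    (S : Set (MixParam n p C)) [SFinite (prior h H)] :
    ∫⁻ x, weightedEvidence h H ξ₀ g x N S
        ∂(Measure.infinitePi fun _ : ℕ => mixMeasure h ξ₀) =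
      ∫⁻ ξ in S, (∫⁻ X, ENNReal.ofReal (mixDensity h ξ X) * g X ∂(stiefelHaar h)) ^ N
        ∂(prior h H) := by
  have := isProbabilityMeasure_mixMeasure h hξ₀
  unfold weightedEvidence
  rw [lintegral_lintegral_swap (measurable_prod_weightedRatio h ξ₀ hg N).aemeasurable]
  refine lintegral_congr fun ξ => ?_
  rw [lintegral_prod_infinitePi _ (measurable_weightedRatio_right h ξ₀ hg ξ),
    lintegral_weightedRatio h hξ₀ hg ξ]

lemma measurable_weightedEvidence (H : Hyper n p C) (ξ₀ : MixParam n p C)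
    {g : Stiefel n p → ENNReal} (hg : Measurable g) (N : ℕ)
    (S : Set (MixParam n p C)) [SFinite (prior h H)] :
    Measurable fun x => weightedEvidence h H ξ₀ g x N S :=
  (measurable_prod_weightedRatio h ξ₀ hg N).lintegral_prod_right'

/-- Weights with product at least one can only increase the evidence. -/
lemma evidence_le_weightedEvidence (H : Hyper n p C) {ξ₀ : MixParam n p C}
    (hξ₀ : ξ₀.2 ∈ openSimplex C) {g : Stiefel n p → ENNReal} {x : ℕ → Stiefel n p} {N : ℕ}
    (hgx : 1 ≤ ∏ i ∈ Finset.range N, g (x i)) {S : Set (MixParam n p C)}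
    (hS : MeasurableSet S) (hSΞ : S ⊆ paramSpace n p C) :
    evidence h H ξ₀ x N S ≤ weightedEvidence h H ξ₀ g x N S := by
  refine setLIntegral_mono' hS fun ξ hξ => ?_
  unfold weightedRatio
  rw [Finset.prod_mul_distrib, likelihoodRatio, ENNReal.ofReal_prod_of_nonneg fun i _ =>
    (div_pos (mixDensity_pos h (hSΞ hξ).2 _) (mixDensity_pos h hξ₀ _)).le]
  exact le_mul_of_one_le_right' hgx

lemma lintegral_ofReal_mixDensity {ξ : MixParam n p C} (hξ : ξ.2 ∈ openSimplex C) :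
    ∫⁻ X, ENNReal.ofReal (mixDensity h ξ X) ∂(stiefelHaar h) = 1 := by
  rw [← ofReal_integral_eq_lintegral_ofReal (integrable_mixDensity h ξ)
    (ae_of_all _ fun X => (mixDensity_pos h hξ X).le), integral_mixDensity h hξ,
    ENNReal.ofReal_one]

/-- With weight one, the expected evidence equals the prior mass of the parameter space, hence it is
finite. -/
lemma ae_evidence_ne_top {H : Hyper n p C} [IsProbabilityMeasure (prior h H)]
    {ξ₀ : MixParam n p C} (hξ₀ : ξ₀.2 ∈ openSimplex C) :
    ∀ᵐ x ∂(Measure.infinitePi fun _ : ℕ => mixMeasure h ξ₀), ∀ N : ℕ,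
      evidence h H ξ₀ x N (paramSpace n p C) ≠ ⊤ := by
  rw [ae_all_iff]
  intro N
  have hE : ∫⁻ x, weightedEvidence h H ξ₀ (fun _ => 1) x N (paramSpace n p C)
      ∂(Measure.infinitePi fun _ : ℕ => mixMeasure h ξ₀) ≠ ⊤ := by
    rw [lintegral_weightedEvidence h H hξ₀ measurable_const]
    have h1 : ∫⁻ ξ in paramSpace n p C,
        (∫⁻ X, ENNReal.ofReal (mixDensity h ξ X) * 1 ∂(stiefelHaar h)) ^ N ∂(prior h H) =
        ∫⁻ _ in paramSpace n p C, 1 ∂(prior h H) :=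
      setLIntegral_congr_fun (measurableSet_paramSpace n p C) fun ξ hξ => by
        simp [lintegral_ofReal_mixDensity h hξ.2]
    rw [h1, setLIntegral_one]
    exact measure_ne_top _ _
  filter_upwards [ae_lt_top (measurable_weightedEvidence h H ξ₀ measurable_const N _) hE] with x hx
  exact ((evidence_le_weightedEvidence h H hξ₀ (by simp)
    (measurableSet_paramSpace n p C) subset_rfl).trans_lt hx).ne

/-! #### Exponential tests for events -/

/-- From `1 - exp (-l) ≥ l / (1 + l)` and `1 - x ≤ exp (-x)`, the left side is at most `exp e` with
`e = l (l (a + δ/2) - δ/2) / (1 + l)`. The choice of `l` gives `l (1 + δ) = δ/2`, hence `e < 0`, and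
`s = exp (e/2)`. The square leaves one power of `s` to divide by the evidence bound and one for
summability. -/
lemma exists_chernoff {a δ : ℝ} (ha0 : 0 ≤ a) (ha1 : a ≤ 1) (hδ : 0 < δ) :
    ∃ l s : ℝ, 0 < l ∧ 0 < s ∧ s < 1 ∧ ∀ q, a + δ ≤ q →
      Real.exp (l * (a + δ / 2)) * (1 - q * (1 - Real.exp (-l))) ≤ s ^ 2 := by
  set l := δ / (2 * (1 + δ)) with hl
  have hl0 : 0 < l := by positivity
  set e := l * (a + δ / 2) - (a + δ) * (l / (1 + l)) with he
  have hlt : l * (a + δ / 2) < δ / 2 := by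
    have h1 : l * (a + δ / 2) ≤ l * (1 + δ / 2) := by gcongr
    have h2 : l * (1 + δ / 2) < l * (1 + δ) := by
      apply mul_lt_mul_of_pos_left _ hl0; linarith
    have h3 : l * (1 + δ) = δ / 2 := by rw [hl]; field_simp
    linarith
  have he0 : e < 0 := by
    have : e = l * (l * (a + δ / 2) - δ / 2) / (1 + l) := by rw [he]; field_simp; ring
    rw [this]
    exact div_neg_of_neg_of_pos (mul_neg_of_pos_of_neg hl0 (by linarith)) (by linarith)
  refine ⟨l, Real.exp (e / 2), hl0, Real.exp_pos _, Real.exp_lt_one_iff.2 (by linarith), fun q hq => ?_⟩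
  have h1 : l / (1 + l) ≤ 1 - Real.exp (-l) := by
    have h2 : Real.exp (-l) ≤ 1 / (1 + l) := by
      rw [Real.exp_neg, ← one_div]
      exact one_div_le_one_div_of_le (by linarith) (by linarith [Real.add_one_le_exp l])
    have h3 : l / (1 + l) = 1 - 1 / (1 + l) := by field_simp; ring
    linarith
  have h4 : (a + δ) * (l / (1 + l)) ≤ q * (1 - Real.exp (-l)) := by
    have : 0 ≤ l / (1 + l) := by positivity
    exact mul_le_mul hq h1 this (by linarith)
  have h5 : 1 - q * (1 - Real.exp (-l)) ≤ Real.exp (-((a + δ) * (l / (1 + l)))) := by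
    have := Real.add_one_le_exp (-((a + δ) * (l / (1 + l))))
    linarith
  calc _ ≤ Real.exp (l * (a + δ / 2)) * Real.exp (-((a + δ) * (l / (1 + l)))) :=
        mul_le_mul_of_nonneg_left h5 (Real.exp_pos _).le
    _ = Real.exp (e / 2) ^ 2 := by
        rw [← Real.exp_add, ← Real.exp_nat_mul, he]; congr 1; push_cast; ring

/-- The Chernoff weight that penalizes the observations in `A`. -/
def chernoffWeight (A : Set (Stiefel n p)) (l t : ℝ) (X : Stiefel n p) : ENNReal :=
  ENNReal.ofReal (Real.exp (l * (t - A.indicator (fun _ => (1 : ℝ)) X)))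

lemma measurable_chernoffWeight {A : Set (Stiefel n p)} (hA : MeasurableSet A) (l t : ℝ) :
    Measurable (chernoffWeight A l t) := by
  have : Measurable (A.indicator fun _ => (1 : ℝ)) := measurable_const.indicator hA
  unfold chernoffWeight
  fun_prop

lemma lintegral_mixDensity_mul_chernoffWeight {A : Set (Stiefel n p)} (hA : MeasurableSet A)
    (l t : ℝ) {ξ : MixParam n p C} (hξ : ξ.2 ∈ openSimplex C) :
    ∫⁻ X, ENNReal.ofReal (mixDensity h ξ X) * chernoffWeight A l t X ∂(stiefelHaar h) =
      ENNReal.ofReal (Real.exp (l * t) * (1 - mixProb h A ξ * (1 - Real.exp (-l)))) := by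
  have hpt : ∀ X, ENNReal.ofReal (mixDensity h ξ X) * chernoffWeight A l t X =
      ENNReal.ofReal (Real.exp (l * t) * (mixDensity h ξ X -
        A.indicator (mixDensity h ξ) X * (1 - Real.exp (-l)))) := by
    intro X
    rw [chernoffWeight, ← ENNReal.ofReal_mul (mixDensity_pos h hξ X).le]
    congr 1
    by_cases hX : X ∈ A
    · simp only [Set.indicator_of_mem hX]
      rw [show l * (t - 1) = l * t + -l by ring, Real.exp_add]
      ring
    · simp only [Set.indicator_of_notMem hX]
      rw [sub_zero]
      ring
  have hi := integrable_mixDensity h ξ (μ := stiefelHaar h)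
  have hiA := (hi.indicator hA).mul_const (1 - Real.exp (-l))
  simp_rw [hpt]
  rw [← ofReal_integral_eq_lintegral_ofReal (f := fun X => Real.exp (l * t) * (mixDensity h ξ X -
    A.indicator (mixDensity h ξ) X * (1 - Real.exp (-l)))) ((hi.sub hiA).const_mul _)]
  · congr 1
    rw [integral_const_mul]
    congr 1
    have := integral_sub hi hiA
    rw [integral_mul_const, integral_indicator hA, integral_mixDensity h hξ] at this
    exact this
  · refine ae_of_all _ fun X => mul_nonneg (Real.exp_pos _).le ?_
    have hpos := mixDensity_pos h hξ X
    have := Real.exp_pos (-l)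
    by_cases hX : X ∈ A
    · simp only [Set.indicator_of_mem hX]
      nlinarith
    · simp only [Set.indicator_of_notMem hX]
      linarith

lemma ae_eventually_sum_indicator_le {A : Set (Stiefel n p)} (hA : MeasurableSet A)
    {ξ₀ : MixParam n p C} (hξ₀ : ξ₀.2 ∈ openSimplex C) {t : ℝ} (ht : mixProb h A ξ₀ < t) :
    ∀ᵐ x ∂(Measure.infinitePi fun _ : ℕ => mixMeasure h ξ₀), ∀ᶠ N : ℕ in atTop,
      ∑ i ∈ Finset.range N, A.indicator (fun _ => (1 : ℝ)) (x i) ≤ N * t := by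
  have := isProbabilityMeasure_mixMeasure h hξ₀
  have hm : Measurable (A.indicator fun _ => (1 : ℝ)) := measurable_const.indicator hA
  have hint : Integrable (A.indicator fun _ => (1 : ℝ)) (mixMeasure h ξ₀) :=
    (integrable_const _).indicator hA
  have hmp := measurePreserving_eval_infinitePi (fun _ : ℕ => mixMeasure h ξ₀)
  have hind := iIndepFun_infinitePi (P := fun _ : ℕ => mixMeasure h ξ₀)
    (X := fun _ => A.indicator fun _ => (1 : ℝ)) fun _ => hm
  -- The strong law for the empirical frequency of `A`, whose mean is `F_{ξ₀}(A) < t`.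
  have key := strong_law_ae_real (μ := Measure.infinitePi fun _ : ℕ => mixMeasure h ξ₀)
    (fun i x => A.indicator (fun _ => (1 : ℝ)) (x i))
    ((hmp 0).integrable_comp_of_integrable hint) (fun i j hij => hind.indepFun hij)
    (fun i => ⟨(hm.comp (measurable_pi_apply i)).aemeasurable,
      (hm.comp (measurable_pi_apply 0)).aemeasurable, by
        have h1 := fun j => Measure.map_map (μ := Measure.infinitePi fun _ : ℕ => mixMeasure h ξ₀)
          hm (measurable_pi_apply (X := fun _ => Stiefel n p) j)
        have h2 : ∀ j, Measure.map (Function.eval j)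
          (Measure.infinitePi fun _ : ℕ => mixMeasure h ξ₀) = mixMeasure h ξ₀ :=
            fun j => (hmp j).map_eq
        exact (h1 i).symm.trans ((congrArg _ ((h2 i).trans (h2 0).symm)).trans (h1 0))⟩)
  have hmean : ∫ x, A.indicator (fun _ => (1 : ℝ)) (x 0)
      ∂(Measure.infinitePi fun _ : ℕ => mixMeasure h ξ₀) = mixProb h A ξ₀ := by
    have h1 : ∫ x, A.indicator (fun _ => (1 : ℝ)) (x 0)
        ∂(Measure.infinitePi fun _ : ℕ => mixMeasure h ξ₀) =
        ∫ X, A.indicator (fun _ => (1 : ℝ)) X ∂(mixMeasure h ξ₀) := by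
      conv_rhs => rw [← (hmp 0).map_eq]
      rw [integral_map (hmp 0).measurable.aemeasurable hm.aestronglyMeasurable]
    rw [h1, integral_mixMeasure h hξ₀, mixProb, ← integral_indicator hA]
    refine integral_congr_ae (ae_of_all _ fun X => ?_)
    by_cases hX : X ∈ A <;> simp [hX]
  rw [hmean] at key
  filter_upwards [key] with x hx
  filter_upwards [hx.eventually_lt_const ht, eventually_gt_atTop 0] with N hN hN0
  have hN0' : (0 : ℝ) < N := by exact_mod_cast hN0
  rw [div_lt_iff₀ hN0'] at hN
  linarith

theorem ae_tendsto_posterior_mixProb_gt {H : Hyper n p C}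
    (hη : ∀ c, IntegrableOn (imdyDensity h (H.ν c) (H.η c)) (posOrthant p) volume)
    (hα : ∀ c, 0 < H.α c) {ξ₀ : MixParam n p C} (hξ₀ : ξ₀ ∈ paramSpace n p C)
    {A : Set (Stiefel n p)} (hA : MeasurableSet A) {δ : ℝ} (hδ : 0 < δ) :
    ∀ᵐ x ∂(Measure.infinitePi fun _ : ℕ => mixMeasure h ξ₀),
      Tendsto (fun N : ℕ => posterior h H ξ₀ x N
        (paramSpace n p C \ {ξ | mixProb h A ξ < mixProb h A ξ₀ + δ})) atTop (𝓝 0) := by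
  have := isProbabilityMeasure_prior h hη hα hξ₀
  set a := mixProb h A ξ₀ with ha
  obtain ⟨ha0, ha1⟩ := mixProb_mem_Icc h hA hξ₀.2
  obtain ⟨l, s, hl, hs0, hs1, hchern⟩ := exists_chernoff ha0 ha1 hδ
  obtain ⟨c, hc0, hctop, hlow⟩ := exists_evidence_lower_bound h hη hα hξ₀ hs0 hs1
  set B := paramSpace n p C \ {ξ | mixProb h A ξ < a + δ} with hB
  have hBm : MeasurableSet B := (measurableSet_paramSpace n p C).diff
    (isOpen_lt (continuous_mixProb h A) continuous_const).measurableSet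
  set g := chernoffWeight (n := n) (p := p) A l (a + δ / 2) with hg
  have hgm : Measurable g := measurable_chernoffWeight hA _ _
  set r := ENNReal.ofReal s with hr
  have hr0 : r ≠ 0 := (ENNReal.ofReal_pos.2 hs0).ne'
  have hrtop : r ≠ ⊤ := ENNReal.ofReal_ne_top
  have hr1 : r < 1 := by rw [hr, ← ENNReal.ofReal_one]; exact (ENNReal.ofReal_lt_ofReal_iff one_pos).2 hs1
  -- The factor `r⁻¹ ^ N` pays for the lower bound `r ^ N * c` on the evidence; of the Chernoff
  -- bound `r ^ (2N)` a summable `r ^ N` remains. The series then has finite expectation, so its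
  -- terms tend to `0` almost surely.
  have hE : ∀ N, ∫⁻ x, (r⁻¹) ^ N * weightedEvidence h H ξ₀ g x N B
      ∂(Measure.infinitePi fun _ : ℕ => mixMeasure h ξ₀) ≤ r ^ N := by
    intro N
    rw [lintegral_const_mul _ (measurable_weightedEvidence h H ξ₀ hgm N B),
      lintegral_weightedEvidence h H hξ₀.2 hgm]
    have hb : ∫⁻ ξ in B, (∫⁻ X, ENNReal.ofReal (mixDensity h ξ X) * g X ∂(stiefelHaar h)) ^ N
        ∂(prior h H) ≤ (r ^ 2) ^ N := by
      calc _ ≤ ∫⁻ _ in B, (r ^ 2) ^ N ∂(prior h H) := by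
            refine setLIntegral_mono' hBm fun ξ hξ => ?_
            rw [lintegral_mixDensity_mul_chernoffWeight h hA _ _ hξ.1.2, hr,
              ← ENNReal.ofReal_pow hs0.le 2]
            gcongr
            exact hchern _ (not_lt.1 hξ.2)
        _ = (r ^ 2) ^ N * prior h H B := setLIntegral_const _ _
        _ ≤ (r ^ 2) ^ N := mul_le_of_le_one_right' prob_le_one
    calc _ ≤ (r⁻¹) ^ N * (r ^ 2) ^ N := mul_le_mul_right hb _
      _ = r ^ N := by
        rw [← mul_pow]; congr 1
        rw [pow_two, ← mul_assoc, ENNReal.inv_mul_cancel hr0 hrtop, one_mul]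
  have hsum : ∫⁻ x, ∑' N, (r⁻¹) ^ N * weightedEvidence h H ξ₀ g x N B
      ∂(Measure.infinitePi fun _ : ℕ => mixMeasure h ξ₀) ≠ ⊤ := by
    rw [lintegral_tsum fun N =>
      ((measurable_weightedEvidence h H ξ₀ hgm N B).const_mul _).aemeasurable]
    refine ne_top_of_le_ne_top ?_ (ENNReal.tsum_le_tsum hE)
    rw [ENNReal.tsum_geometric]
    exact ENNReal.inv_ne_top.2 (tsub_pos_of_lt hr1).ne'
  have hfin := ae_lt_top (Measurable.tsum fun N =>
      ((measurable_weightedEvidence h H ξ₀ hgm N B).const_mul ((r⁻¹) ^ N))) hsum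
  have hslln := ae_eventually_sum_indicator_le h hA hξ₀.2
    (show mixProb h A ξ₀ < a + δ / 2 by linarith)
  filter_upwards [hfin, hslln] with x hx1 hx2
  have hT := ENNReal.tendsto_atTop_zero_of_tsum_ne_top hx1.ne
  have hT' : Tendsto (fun N => c⁻¹ * ((r⁻¹) ^ N * weightedEvidence h H ξ₀ g x N B)) atTop
      (𝓝 0) := by
    have := ENNReal.Tendsto.const_mul hT (Or.inr (ENNReal.inv_ne_top.2 hc0))
    rwa [mul_zero] at this
  refine tendsto_of_tendsto_of_tendsto_of_le_of_le' tendsto_const_nhds hT'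
    (Eventually.of_forall fun _ => zero_le) ?_
  filter_upwards [hx2] with N hN
  -- The weights multiply to `exp (l (N t - #{i < N : x i ∈ A}))` with `t = a + δ / 2`, whose
  -- exponent is nonnegative by the frequency bound `hN`.
  have hge : 1 ≤ ∏ i ∈ Finset.range N, g (x i) := by
    simp only [hg, chernoffWeight]
    rw [← ENNReal.ofReal_prod_of_nonneg fun _ _ => (Real.exp_pos _).le, ← Real.exp_sum,
      ← Finset.mul_sum, Finset.sum_sub_distrib, ENNReal.one_le_ofReal, Real.one_le_exp_iff]
    simp only [Finset.sum_const, Finset.card_range, nsmul_eq_mul]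
    exact mul_nonneg hl.le (by linarith)
  calc posterior h H ξ₀ x N B
      ≤ weightedEvidence h H ξ₀ g x N B / (r ^ N * c) :=
        ENNReal.div_le_div (evidence_le_weightedEvidence h H hξ₀.2 hge hBm Set.sdiff_subset)
          (hlow x N)
    _ = c⁻¹ * ((r⁻¹) ^ N * weightedEvidence h H ξ₀ g x N B) := by
        rw [div_eq_mul_inv, ENNReal.mul_inv (Or.inr hctop) (Or.inr hc0), ENNReal.inv_pow]
        ring

/-! ### Setwise convergence along the concentration filter -/

/-- The filter of sets of parameters on which the posterior almost surely concentrates. -/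
def concentrationFilter (H : Hyper n p C) (ξ₀ : MixParam n p C) : Filter (MixParam n p C) where
  sets := {S | ∀ᵐ x ∂(Measure.infinitePi fun _ : ℕ => mixMeasure h ξ₀),
    Tendsto (fun N : ℕ => posterior h H ξ₀ x N (paramSpace n p C \ S)) atTop (𝓝 0)}
  univ_sets := by simp [posterior, evidence]
  sets_of_superset := by
    intro S T hS hST
    simp only [Set.mem_ofPred_eq] at hS ⊢
    filter_upwards [hS] with x hx
    refine tendsto_of_tendsto_of_tendsto_of_le_of_le tendsto_const_nhds hx
      (fun _ => zero_le) fun N => ?_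
    exact ENNReal.div_le_div_right (lintegral_mono_set (Set.sdiff_subset_sdiff_right hST)) _
  inter_sets := by
    intro S T hS hT
    simp only [Set.mem_ofPred_eq] at hS hT ⊢
    filter_upwards [hS, hT] with x hx hy
    have hxy := hx.add hy
    rw [add_zero] at hxy
    refine tendsto_of_tendsto_of_tendsto_of_le_of_le tendsto_const_nhds hxy
      (fun _ => zero_le) fun N => ?_
    simp only [posterior]
    rw [← ENNReal.add_div, Set.sdiff_inter]
    exact ENNReal.div_le_div_right (lintegral_union_le _ _ _) _

lemma paramSpace_mem_concentrationFilter (H : Hyper n p C) (ξ₀ : MixParam n p C) :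
    paramSpace n p C ∈ concentrationFilter h H ξ₀ := by
  change ∀ᵐ x ∂_, _
  simp [posterior, evidence]

/-- The tests give upper bounds only; the lower bound for `A` is the upper bound for its complement.
-/
lemma tendsto_mixProb_concentrationFilter {H : Hyper n p C}
    (hη : ∀ c, IntegrableOn (imdyDensity h (H.ν c) (H.η c)) (posOrthant p) volume)
    (hα : ∀ c, 0 < H.α c) {ξ₀ : MixParam n p C} (hξ₀ : ξ₀ ∈ paramSpace n p C)
    {A : Set (Stiefel n p)} (hA : MeasurableSet A) :
    Tendsto (mixProb h A) (concentrationFilter h H ξ₀) (𝓝 (mixProb h A ξ₀)) := by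
  have hup : ∀ B : Set (Stiefel n p), MeasurableSet B → ∀ δ > 0,
      ∀ᶠ ξ in concentrationFilter h H ξ₀, mixProb h B ξ < mixProb h B ξ₀ + δ :=
    fun B hB δ hδ => ae_tendsto_posterior_mixProb_gt h hη hα hξ₀ hB hδ
  rw [Metric.tendsto_nhds]
  intro δ hδ
  filter_upwards [hup A hA δ hδ, hup Aᶜ hA.compl δ hδ,
    paramSpace_mem_concentrationFilter h H ξ₀] with ξ h1 h2 h3
  rw [mixProb_compl h hA h3.2, mixProb_compl h hA hξ₀.2] at h2
  rw [Real.dist_eq, abs_lt]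
  constructor <;> linarith

end Posterior

/-! ### Concentration of matrix Langevin distributions -/

section Concentration

variable {n p C : ℕ} (h : p ≤ n)

lemma sum_sq_column (X : Stiefel n p) (j : Fin p) : ∑ i, X.1 i j ^ 2 = 1 := by
  have := congrFun (congrFun X.2 j) j
  simp only [Matrix.mul_apply, Matrix.transpose_apply, Matrix.one_apply_eq] at this
  simpa [pow_two] using this

lemma stiefel_apply_le_one (X : Stiefel n p) (i : Fin n) (j : Fin p) : X.1 i j ≤ 1 := by
  have h1 := Finset.single_le_sum (f := fun i => X.1 i j ^ 2) (fun i _ => sq_nonneg _)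
    (Finset.mem_univ i)
  simp only [sum_sq_column] at h1
  nlinarith

lemma stiefel_column_eq_zero {X : Stiefel n p} {i : Fin n} {j : Fin p} (hX : X.1 i j = 1)
    {k : Fin n} (hk : k ≠ i) : X.1 k j = 0 := by
  have h1 := sum_sq_column X j
  rw [← Finset.add_sum_erase _ _ (Finset.mem_univ i), hX] at h1
  have h2 := Finset.single_le_sum (s := Finset.univ.erase i) (f := fun i => X.1 i j ^ 2)
    (fun i _ => sq_nonneg _) (Finset.mem_erase.2 ⟨hk, Finset.mem_univ k⟩)
  exact pow_eq_zero_iff (two_ne_zero) |>.1 (le_antisymm (by linarith) (sq_nonneg _))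

lemma exists_orthGroup_apply_eq (i k : Fin n) (hik : k ≠ i) {t : ℝ} (ht : t ∈ Set.Icc (0 : ℝ) 1) :
    ∃ Q : OrthGroup n, Q.1 i i = t := by
  let u : EuclideanSpace ℝ (Fin n) :=
    WithLp.toLp 2 fun l => if l = i then t else if l = k then Real.sqrt (1 - t ^ 2) else 0
  have hu : Orthonormal ℝ (Set.domRestrict {i} fun _ : Fin n => u) := by
    refine ⟨fun _ => ?_, fun a b hab => (hab (Subsingleton.elim a b)).elim⟩
    rw [Set.domRestrict_apply, EuclideanSpace.norm_eq, Real.sqrt_eq_one]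
    have h1 : ∀ l, ‖u l‖ ^ 2 = (if l = i then t ^ 2 else 0) + if l = k then 1 - t ^ 2 else 0 := by
      intro l
      simp only [u]
      by_cases hl : l = i
      · have hlk : l ≠ k := fun hc => hik (hc.symm.trans hl)
        simp [hl, hik.symm]
      · by_cases hlk : l = k
        · simp only [if_false, hlk, hik, if_true, Real.norm_eq_abs, sq_abs, zero_add]
          exact Real.sq_sqrt (by nlinarith [ht.1, ht.2])
        · simp [hl, hlk]
    simp_rw [h1, Finset.sum_add_distrib]
    simp
  obtain ⟨Q, hQ⟩ := exists_orthGroup_columns _ hu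
  refine ⟨Q, ?_⟩
  rw [hQ i rfl i]
  simp [u]

/-- Where `X i j = 1`, column `j` is the basis vector `e_i`, and an orthogonal `Q` with `Q i i = t`
carries this set into `{X i j = t}`. By invariance these disjoint sets, one for each `t ∈ [0, 1]`,
are all at least as large as the original, which is impossible in a finite measure unless it is
null. Rotating `e_i` in this way needs a second coordinate, hence `2 ≤ n`. -/
lemma stiefelHaar_apply_eq_one_null (hn : 2 ≤ n) (i : Fin n) (j : Fin p) :
    stiefelHaar h {X | X.1 i j = 1} = 0 := by
  obtain ⟨k, hk⟩ : ∃ k : Fin n, k ≠ i := by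
    have : Nontrivial (Fin n) := Fin.nontrivial_iff_two_le.2 hn
    exact exists_ne i
  let A : Set.Icc (0 : ℝ) 1 → Set (Stiefel n p) := fun t => {X | X.1 i j = t}
  have hA : ∀ t, MeasurableSet (A t) := fun t =>
    (isClosed_eq (continuous_apply_stiefel i j) continuous_const).measurableSet
  have hdisj : Pairwise (Function.onFun Disjoint A) := by
    intro s t hst
    refine Set.disjoint_left.2 fun X hs ht => hst (Subtype.ext ?_)
    exact (show X.1 i j = s from hs).symm.trans ht
  have hle : ∀ t, stiefelHaar h {X | X.1 i j = 1} ≤ stiefelHaar h (A t) := by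
    intro t
    obtain ⟨Q, hQ⟩ := exists_orthGroup_apply_eq i k hk t.2
    rw [← (measurePreserving_twoSidedMul h Q 1).measure_preimage (hA t).nullMeasurableSet]
    refine measure_mono fun X hX => ?_
    have hX' : X.1 i j = 1 := hX
    change (Q.1 * X.1 * (1 : Matrix (Fin p) (Fin p) ℝ)) i j = t
    rw [Matrix.mul_one, Matrix.mul_apply, Finset.sum_eq_single i, hX', hQ, mul_one]
    · intro l _ hl
      rw [stiefel_column_eq_zero hX' hl, mul_zero]
    · simp
  by_contra hne
  have hfin := Measure.finite_const_le_meas_of_disjoint_iUnion (stiefelHaar h)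
    (pos_iff_ne_zero.2 hne) hA hdisj (measure_ne_top _ _)
  have huniv : {t | stiefelHaar h {X | X.1 i j = 1} ≤ stiefelHaar h (A t)} = Set.univ :=
    Set.eq_univ_of_forall hle
  rw [huniv, Set.finite_univ_iff] at hfin
  exact (Set.Icc_infinite (zero_lt_one' ℝ)).not_finite hfin

lemma diagCoord_le_one (M : Stiefel n p) (V : Stiefel p p) (X : Stiefel n p) (j : Fin p) :
    diagCoord M V X j ≤ 1 := by
  by_cases h : p ≤ n
  · obtain ⟨Φ, -, hd⟩ := exists_measurePreserving_diagCoord h M V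
    rw [hd]
    exact stiefel_apply_le_one _ _ _
  · exact absurd (show p ≤ n from by
      have h1 := Matrix.rank_mul_le_right M.1.transpose M.1
      rw [M.2, Matrix.rank_one, Fintype.card_fin] at h1
      simpa using h1.trans M.1.rank_le_height) h

/-! ### Concentration of a component as its largest parameter grows -/

/-- The Haar measure of the frames close to the standard one. -/
def haarNearIdentity (δ : ℝ) : ℝ :=
  (stiefelHaar h).real {X : Stiefel n p | ∑ j, (1 - X.1 (Fin.castLE h j) j) < δ}

lemma isOpen_nearIdentity (δ : ℝ) :
    IsOpen {X : Stiefel n p | ∑ j, (1 - X.1 (Fin.castLE h j) j) < δ} :=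
  isOpen_lt (continuous_finsetSum _ fun j _ =>
    continuous_const.sub (continuous_apply_stiefel _ j)) continuous_const

lemma haarNearIdentity_pos {δ : ℝ} (hδ : 0 < δ) : 0 < haarNearIdentity (p := p) h δ := by
  refine ENNReal.toReal_pos ((isOpen_nearIdentity h δ).measure_ne_zero _ ⟨frame h 1, ?_⟩)
    (measure_ne_top _ _)
  have h1 : ∀ j : Fin p, (frame h 1).1 (Fin.castLE h j) j = 1 := fun j =>
    Matrix.one_apply_eq (Fin.castLE h j)
  simpa only [h1, sub_self, Finset.sum_const_zero, Set.mem_ofPred_eq] using hδ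

/-- Restrict the integral to frames with `∑ (1 - X_jj) < δ`: there the exponent falls short of its
maximum `∑ d_j` by at most `r δ`. -/
lemma hyp0F1_lower_bound {d : Fin p → ℝ} {r δ : ℝ} (hd : ∀ j, d j ≤ r) (hr : 0 ≤ r) :
    haarNearIdentity h δ * Real.exp (∑ j, d j - r * δ) ≤ hyp0F1 h d := by
  have hc : Continuous fun X : Stiefel n p => Real.exp (∑ j, d j * X.1 (Fin.castLE h j) j) :=
    Real.continuous_exp.comp (continuous_finsetSum _ fun j _ =>
      continuous_const.mul (continuous_apply_stiefel _ j))
  have hi := integrable_of_continuous_of_compactSpace (μ := stiefelHaar h) hc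
  have hm := (isOpen_nearIdentity (p := p) h δ).measurableSet
  rw [hyp0F1_eq, haarNearIdentity, ← smul_eq_mul, ← setIntegral_const]
  refine (setIntegral_mono_on (integrable_const _).integrableOn hi.integrableOn hm
    fun X hX => ?_).trans (setIntegral_le_integral hi (ae_of_all _ fun X => (Real.exp_pos _).le))
  refine Real.exp_le_exp.2 ?_
  have h1 : ∑ j, d j * (1 - X.1 (Fin.castLE h j) j) ≤
      r * ∑ j, (1 - X.1 (Fin.castLE h j) j) := by
    rw [Finset.mul_sum]
    exact Finset.sum_le_sum fun j _ => mul_le_mul_of_nonneg_right (hd j)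
      (by linarith [stiefel_apply_le_one X (Fin.castLE h j) j])
  have h2 : r * ∑ j, (1 - X.1 (Fin.castLE h j) j) ≤ r * δ :=
    mul_le_mul_of_nonneg_left (le_of_lt hX) hr
  have h3 : ∑ j, d j * (1 - X.1 (Fin.castLE h j) j) =
      ∑ j, d j - ∑ j, d j * X.1 (Fin.castLE h j) j := by
    rw [← Finset.sum_sub_distrib]
    exact Finset.sum_congr rfl fun j _ => by ring
  linarith

/-- Away from the set where its leading coordinate is close to one, a matrix Langevin density with
large leading concentration parameter is uniformly small. -/
lemma mlDensity_le_exp {θ : MLParam n p} {j : Fin p} {δ : ℝ} (hδ : 0 < δ)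
    (hd0 : ∀ k, 0 ≤ θ.2.1 k) (hd : ∀ k, θ.2.1 k ≤ θ.2.1 j) {X : Stiefel n p}
    (hX : diagCoord θ.1 θ.2.2 X j ≤ 1 - δ) :
    mlDensity h θ X ≤ Real.exp (-(θ.2.1 j * (δ / 2))) / haarNearIdentity (p := p) h (δ / 2) := by
  -- Half of `δ` is given up in the normalizing constant: the numerator loses `d_j δ`, the
  -- denominator at most `d_j δ / 2`, and the difference is the decay rate.
  have hZ := hyp0F1_lower_bound h (δ := δ / 2) hd (hd0 j)
  have hc := haarNearIdentity_pos (p := p) h (half_pos hδ)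
  rw [mlDensity_eq, div_le_div_iff₀ (hyp0F1_pos h _) hc]
  have hexp : ∑ k, θ.2.1 k * diagCoord θ.1 θ.2.2 X k ≤ ∑ k, θ.2.1 k - θ.2.1 j * δ := by
    rw [← Finset.add_sum_erase _ _ (Finset.mem_univ j),
      ← Finset.add_sum_erase _ (fun k => θ.2.1 k) (Finset.mem_univ j)]
    have h1 : ∑ k ∈ Finset.univ.erase j, θ.2.1 k * diagCoord θ.1 θ.2.2 X k ≤
        ∑ k ∈ Finset.univ.erase j, θ.2.1 k := Finset.sum_le_sum fun k _ =>
      mul_le_of_le_one_right (hd0 k) (diagCoord_le_one _ _ _ _)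
    have h2 := mul_le_mul_of_nonneg_left hX (hd0 j)
    linarith
  calc _ ≤ Real.exp (∑ k, θ.2.1 k - θ.2.1 j * δ) * haarNearIdentity (p := p) h (δ / 2) :=
        mul_le_mul_of_nonneg_right (Real.exp_le_exp.2 hexp) hc.le
    _ = Real.exp (-(θ.2.1 j * (δ / 2))) *
        (haarNearIdentity h (δ / 2) * Real.exp (∑ k, θ.2.1 k - θ.2.1 j * (δ / 2))) := by
        rw [mul_left_comm, ← Real.exp_add, mul_comm]
        congr 2
        ring
    _ ≤ _ := mul_le_mul_of_nonneg_left hZ (Real.exp_pos _).le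

lemma stiefelHaar_diagCoord_eq_one_null (hn : 2 ≤ n) (M : Stiefel n p) (V : Stiefel p p)
    (j : Fin p) : stiefelHaar h {X | diagCoord M V X j = 1} = 0 := by
  obtain ⟨Φ, hΦ, hd⟩ := exists_measurePreserving_diagCoord h M V
  have h1 : {X | diagCoord M V X j = 1} = Φ ⁻¹' {X | X.1 (Fin.castLE h j) j = 1} := by
    ext X
    change diagCoord M V X j = 1 ↔ (Φ X).1 (Fin.castLE h j) j = 1
    rw [hd]
  have hm : MeasurableSet {X : Stiefel n p | X.1 (Fin.castLE h j) j = 1} :=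
    (isClosed_eq (continuous_apply_stiefel _ j) continuous_const).measurableSet
  rw [h1, hΦ.measure_preimage hm.nullMeasurableSet]
  exact stiefelHaar_apply_eq_one_null h hn _ _

lemma continuous_diagCoord_right (M : Stiefel n p) (V : Stiefel p p) (j : Fin p) :
    Continuous fun X : Stiefel n p => diagCoord M V X j :=
  (continuous_diagCoord j).comp
    (f := fun X : Stiefel n p => (M, V, X)) (by fun_prop)

/-- The set of frames whose `j`-th diagonal coordinate is close to one. -/
def cap (M : Stiefel n p) (V : Stiefel p p) (j : Fin p) (δ : ℝ) : Set (Stiefel n p) :=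
  {X | 1 - δ ≤ diagCoord M V X j}

lemma measurableSet_cap (M : Stiefel n p) (V : Stiefel p p) (j : Fin p) (δ : ℝ) :
    MeasurableSet (cap M V j δ) :=
  (isClosed_le continuous_const (continuous_diagCoord_right M V j)).measurableSet

/-- Diagonal coordinates never exceed one, so the caps decrease to the Haar-null set where the
coordinate equals one, and the mixture law is absolutely continuous. -/
lemma tendsto_mixProb_cap (hn : 2 ≤ n) (M : Stiefel n p) (V : Stiefel p p) (j : Fin p)
    (ξ : MixParam n p C) :
    Tendsto (fun k : ℕ => mixProb h (cap M V j (1 / ((k : ℝ) + 1))) ξ) atTop (𝓝 0) := by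
  have hanti : Antitone fun k : ℕ => cap M V j (1 / ((k : ℝ) + 1)) := by
    intro k l hkl X hX
    have h1 : 1 / ((l : ℝ) + 1) ≤ 1 / ((k : ℝ) + 1) := Nat.one_div_le_one_div hkl
    have h2 : 1 - 1 / ((l : ℝ) + 1) ≤ diagCoord M V X j := hX
    change 1 - 1 / ((k : ℝ) + 1) ≤ diagCoord M V X j
    linarith
  have key := tendsto_setIntegral_of_antitone (μ := stiefelHaar h) (f := mixDensity h ξ)
    (fun k : ℕ => measurableSet_cap M V j (1 / ((k : ℝ) + 1))) hanti
    ⟨0, (integrable_mixDensity h ξ).integrableOn⟩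
  have hnull : stiefelHaar h (⋂ k : ℕ, cap M V j (1 / ((k : ℝ) + 1))) = 0 := by
    refine measure_mono_null (fun X hX => ?_) (stiefelHaar_diagCoord_eq_one_null h hn M V j)
    rw [Set.mem_iInter] at hX
    refine le_antisymm (diagCoord_le_one M V X j) ?_
    have hlim : Tendsto (fun k : ℕ => 1 - 1 / ((k : ℝ) + 1)) atTop (𝓝 (1 - 0)) :=
      tendsto_const_nhds.sub tendsto_one_div_add_atTop_nhds_zero_nat
    rw [sub_zero] at hlim
    exact le_of_tendsto' hlim hX
  rwa [setIntegral_measure_zero _ hnull] at key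

end Concentration

/-! ### Setwise convergence of mixtures implies convergence in mean -/

section Ultrafilter

variable {n p C : ℕ} (h : p ≤ n)

lemma exists_tendsto_of_eventually_mem {α X : Type*} [TopologicalSpace X] {K : Set X}
    (hK : IsCompact K) (u : Ultrafilter α) {f : α → X} (hf : ∀ᶠ a in u, f a ∈ K) :
    ∃ x ∈ K, Tendsto f u (𝓝 x) :=
  isCompact_iff_ultrafilter_le_nhds.1 hK (u.map f) (le_principal_iff.2 hf)

/-- The integral of `|F x' - F x|` depends continuously on `x'` and vanishes at `x' = x`. -/
lemma tendsto_integral_of_tendsto {α X Y : Type*} [TopologicalSpace X]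
    [FirstCountableTopology X] [LocallyCompactSpace X] [TopologicalSpace Y] [CompactSpace Y]
    [SecondCountableTopology Y] [MeasurableSpace Y] [OpensMeasurableSpace Y] {μ : Measure Y}
    [IsFiniteMeasure μ] {F : X → Y → ℝ} (hF : Continuous F.uncurry) {l : Filter α} {f : α → X}
    {x : X} (hf : Tendsto f l (𝓝 x)) :
    Tendsto (fun a => ∫ y, |F (f a) y - F x y| ∂μ) l (𝓝 0) := by
  have hc : Continuous (Function.uncurry fun (x' : X) (y : Y) => |F x' y - F x y|) :=
    (hF.sub (hF.comp (continuous_const.prodMk continuous_snd))).abs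
  have h1 := (continuous_integral_of_compactSpace (μ := μ) hc).tendsto x
  simp only [sub_self, abs_zero, integral_zero] at h1
  exact h1.comp hf

/-- A weighted matrix Langevin density, as a function of weight and parameter. -/
def weightedML (q : MLParam n p × ℝ) (X : Stiefel n p) : ℝ := q.2 * mlDensity h q.1 X

lemma continuous_weightedML : Continuous (Function.uncurry (weightedML h)) := by
  have h1 : Continuous fun q : (MLParam n p × ℝ) × Stiefel n p => (q.1.1, q.2) := by fun_prop
  have h2 : Continuous fun q : (MLParam n p × ℝ) × Stiefel n p => mlDensity h q.1.1 q.2 :=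
    Continuous.comp (g := fun q : MLParam n p × Stiefel n p => mlDensity h q.1 q.2)
      (f := fun q : (MLParam n p × ℝ) × Stiefel n p => (q.1.1, q.2)) (continuous_mlDensity h) h1
  exact (continuous_snd.comp continuous_fst).mul h2

lemma openSimplex_le_one {w : Fin C → ℝ} (hw : w ∈ openSimplex C) (c : Fin C) : w c ≤ 1 := by
  rw [← hw.2]
  exact Finset.single_le_sum (fun c _ => (hw.1 c).le) (Finset.mem_univ c)

variable {u : Ultrafilter (MixParam n p C)}

/-- The pair (component parameter, weight) stays in a compact set, so it converges along the
ultrafilter. The limit may leave the parameter space (concentrations zero or tied, weight zero);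
this is harmless because the density is continuous there too. -/
lemma tendsto_weightedML_of_bounded (hu : ∀ᶠ ξ in u, ξ ∈ paramSpace n p C)
    {c : Fin C} {R : ℝ} (hR : ∀ᶠ ξ : MixParam n p C in u, ∀ j, (ξ.1 c).2.1 j ≤ R) :
    ∃ g : Stiefel n p → ℝ, Integrable g (stiefelHaar h) ∧
      Tendsto (fun ξ : MixParam n p C => ∫ X, |ξ.2 c * mlDensity h (ξ.1 c) X - g X|
        ∂(stiefelHaar h)) u (𝓝 0) := by
  let K : Set (MLParam n p × ℝ) :=
    (Set.univ ×ˢ ((Set.univ.pi fun _ => Set.Icc 0 R) ×ˢ Set.univ)) ×ˢ Set.Icc 0 1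
  have hK : IsCompact K := (isCompact_univ.prod ((isCompact_univ_pi fun _ => isCompact_Icc).prod
    isCompact_univ)).prod isCompact_Icc
  obtain ⟨q, -, hq⟩ := exists_tendsto_of_eventually_mem hK u
    (f := fun ξ : MixParam n p C => (ξ.1 c, ξ.2 c)) (by
      filter_upwards [hu, hR] with ξ hξ hξR
      exact ⟨⟨trivial, fun j _ => ⟨((hξ.1 c).2.1 j).le, hξR j⟩, trivial⟩,
        (hξ.2.1 c).le, openSimplex_le_one hξ.2 c⟩)
  refine ⟨weightedML h q, integrable_of_continuous_of_compactSpace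
    ((continuous_const).mul (continuous_mlDensity_right h q.1)), ?_⟩
  exact tendsto_integral_of_tendsto (continuous_weightedML h) hq

lemma setIntegral_weighted_mlDensity_le_mixProb {ξ : MixParam n p C} (hξ : ξ ∈ paramSpace n p C)
    (c : Fin C) (A : Set (Stiefel n p)) :
    ξ.2 c * ∫ X in A, mlDensity h (ξ.1 c) X ∂(stiefelHaar h) ≤ mixProb h A ξ := by
  rw [← integral_const_mul, mixProb]
  refine integral_mono ((integrable_of_continuous_of_compactSpace
    (continuous_mlDensity_right h _)).const_mul _) (integrable_mixDensity h ξ) fun X => ?_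
  exact Finset.single_le_sum (f := fun c => ξ.2 c * mlDensity h (ξ.1 c) X)
    (fun c _ => (mul_pos (hξ.2.1 c) (mlDensity_pos h _ X)).le) (Finset.mem_univ c)

lemma setIntegral_mlDensity_ge {θ : MLParam n p} {A : Set (Stiefel n p)} (hA : MeasurableSet A)
    {b : ℝ} (hb0 : 0 ≤ b) (hb : ∀ X ∉ A, mlDensity h θ X ≤ b) :
    1 - b ≤ ∫ X in A, mlDensity h θ X ∂(stiefelHaar h) := by
  have hi := integrable_of_continuous_of_compactSpace (μ := stiefelHaar h)
    (continuous_mlDensity_right h θ)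
  have h1 := integral_add_compl hA hi
  rw [integral_mlDensity] at h1
  have h2 : ∫ X in Aᶜ, mlDensity h θ X ∂(stiefelHaar h) ≤ b := by
    calc _ ≤ ∫ _ in Aᶜ, b ∂(stiefelHaar h) :=
          setIntegral_mono_on hi.integrableOn (integrable_const _).integrableOn hA.compl hb
      _ = (stiefelHaar h).real Aᶜ * b := by rw [setIntegral_const, smul_eq_mul]
      _ ≤ b := mul_le_of_le_one_left hb0 measureReal_le_one
  linarith

lemma eventually_diagCoord_near {α : Type*} {l : Filter α} {f : α → Stiefel n p × Stiefel p p}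
    {M : Stiefel n p} {V : Stiefel p p} (hf : Tendsto f l (𝓝 (M, V))) (j : Fin p)
    {δ : ℝ} (hδ : 0 < δ) :
    ∀ᶠ a in l, ∀ X, diagCoord (f a).1 (f a).2 X j ≤ diagCoord M V X j + δ := by
  have h1 : Continuous fun q : (Stiefel n p × Stiefel p p) × Stiefel n p =>
      diagCoord q.1.1 q.1.2 q.2 j :=
    (continuous_diagCoord j).comp
      (f := fun q : (Stiefel n p × Stiefel p p) × Stiefel n p => (q.1.1, q.1.2, q.2))
      (by fun_prop)
  have h2 : Continuous fun q : (Stiefel n p × Stiefel p p) × Stiefel n p =>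
      diagCoord M V q.2 j + δ :=
    ((continuous_diagCoord_right M V j).comp continuous_snd).add continuous_const
  have key := isCompact_univ.eventually_forall_of_forall_eventually (x₀ := (M, V))
    (P := fun q X => diagCoord q.1 q.2 X j < diagCoord M V X j + δ)
    (K := (Set.univ : Set (Stiefel n p))) fun X _ =>
      (isOpen_lt h1 h2).mem_nhds (by simpa using hδ)
  exact (hf.eventually key).mono fun a ha X => (ha X trivial).le

/-- A component with diverging largest concentration puts almost all its mass on every cap around
the limit frames, so the limiting weight `w` is at most the `F_{ξ₀}`-mass of each cap, which shrinks
to zero. -/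
lemma tendsto_weight_of_unbounded (hn : 2 ≤ n) (hu : ∀ᶠ ξ in u, ξ ∈ paramSpace n p C)
    {ξ₀ : MixParam n p C}
    (hlim : ∀ A, MeasurableSet A → Tendsto (mixProb h A : MixParam n p C → ℝ) u (𝓝 (mixProb h A ξ₀)))
    {c : Fin C} {j : Fin p} (hj : ∀ k, j ≤ k)
    (hr : Tendsto (fun ξ : MixParam n p C => (ξ.1 c).2.1 j) u atTop) :
    Tendsto (fun ξ : MixParam n p C => ξ.2 c) u (𝓝 0) := by
  obtain ⟨w, hw01, hw⟩ := exists_tendsto_of_eventually_mem (isCompact_Icc (a := (0 : ℝ)) (b := 1)) u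
    (f := fun ξ : MixParam n p C => ξ.2 c)
    (hu.mono fun ξ hξ => ⟨(hξ.2.1 c).le, openSimplex_le_one hξ.2 c⟩)
  obtain ⟨⟨M, V⟩, -, hMV⟩ := exists_tendsto_of_eventually_mem
    (isCompact_univ (X := Stiefel n p × Stiefel p p)) u
    (f := fun ξ : MixParam n p C => ((ξ.1 c).1, (ξ.1 c).2.2)) (Eventually.of_forall fun _ => trivial)
  have hcap : ∀ δ > 0, w ≤ mixProb h (cap M V j δ) ξ₀ := by
    intro δ hδ
    -- The cap is centred at the limit `(M, V)`, not at the moving frames. One half of `δ` absorbs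
    -- the distance between them; the other enters the density bound, which halves it again.
    set b : MixParam n p C → ℝ := fun ξ =>
      Real.exp (-((ξ.1 c).2.1 j * (δ / 2 / 2))) / haarNearIdentity (p := p) h (δ / 2 / 2) with hb
    have hblim : Tendsto b u (𝓝 0) := by
      have h1 : Tendsto (fun ξ : MixParam n p C => (ξ.1 c).2.1 j * (δ / 2 / 2)) u atTop :=
        hr.atTop_mul_const (by positivity)
      have h2 := (Real.tendsto_exp_neg_atTop_nhds_zero.comp h1).div_const
        (haarNearIdentity (p := p) h (δ / 2 / 2))
      rwa [zero_div] at h2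
    have hleft : Tendsto (fun ξ : MixParam n p C => ξ.2 c * (1 - b ξ)) u (𝓝 (w * (1 - 0))) :=
      hw.mul (tendsto_const_nhds.sub hblim)
    rw [sub_zero, mul_one] at hleft
    refine le_of_tendsto_of_tendsto hleft (hlim _ (measurableSet_cap M V j δ)) ?_
    filter_upwards [hu, eventually_diagCoord_near hMV j (half_pos hδ)] with ξ hξ hnear
    refine le_trans (mul_le_mul_of_nonneg_left ?_ (hξ.2.1 c).le)
      (setIntegral_weighted_mlDensity_le_mixProb h hξ c _)
    refine setIntegral_mlDensity_ge h (measurableSet_cap M V j δ)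
      (div_pos (Real.exp_pos _) (haarNearIdentity_pos h (by positivity))).le fun X hX => ?_
    have hX' : diagCoord M V X j < 1 - δ := not_le.1 hX
    exact mlDensity_le_exp h (half_pos hδ) (fun k => ((hξ.1 c).2.1 k).le)
      (fun k => (hξ.1 c).2.2.antitone (hj k)) (by linarith [hnear X])
  have hw0 : w ≤ 0 := ge_of_tendsto' (tendsto_mixProb_cap h hn M V j ξ₀) fun k =>
    hcap _ Nat.one_div_pos_of_nat
  rwa [le_antisymm hw0 hw01.1] at hw

lemma exists_tendsto_weighted_mlDensity (hp : 1 ≤ p) (hn : 2 ≤ n)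
    (hu : ∀ᶠ ξ in u, ξ ∈ paramSpace n p C) {ξ₀ : MixParam n p C}
    (hlim : ∀ A, MeasurableSet A → Tendsto (mixProb h A : MixParam n p C → ℝ) u (𝓝 (mixProb h A ξ₀))) (c : Fin C) :
    ∃ g : Stiefel n p → ℝ, Integrable g (stiefelHaar h) ∧
      Tendsto (fun ξ : MixParam n p C => ∫ X, |ξ.2 c * mlDensity h (ξ.1 c) X - g X|
        ∂(stiefelHaar h)) u (𝓝 0) := by
  -- Index `0` carries the largest concentration, so bounding it bounds all of them.
  let j : Fin p := ⟨0, hp⟩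
  have hj : ∀ k, j ≤ k := fun k => Nat.zero_le _
  by_cases hb : ∃ R, ∀ᶠ ξ : MixParam n p C in u, (ξ.1 c).2.1 j ≤ R
  · obtain ⟨R, hR⟩ := hb
    refine tendsto_weightedML_of_bounded h hu (R := R) ?_
    filter_upwards [hu, hR] with ξ hξ hξR k
    exact ((hξ.1 c).2.2.antitone (hj k)).trans hξR
  -- An ultrafilter contains each set or its complement, so failure of every bound `R` means
  -- eventual excess over every `R`.
  · push Not at hb
    have hr : Tendsto (fun ξ : MixParam n p C => (ξ.1 c).2.1 j) u atTop := by
      refine tendsto_atTop.2 fun R => ?_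
      exact (hb R).mono fun ξ hξ => hξ.le
    refine ⟨0, integrable_zero _ _ _, ?_⟩
    refine (tendsto_weight_of_unbounded h hn hu hlim hj hr).congr' ?_
    filter_upwards [hu] with ξ hξ
    have h1 : ∀ X, |ξ.2 c * mlDensity h (ξ.1 c) X - (0 : Stiefel n p → ℝ) X| =
        ξ.2 c * mlDensity h (ξ.1 c) X := fun X => by
      rw [Pi.zero_apply, sub_zero, abs_of_pos (mul_pos (hξ.2.1 c) (mlDensity_pos h _ X))]
    simp_rw [h1]
    rw [integral_const_mul, integral_mlDensity, mul_one]

/-- Component limits add up to an `L¹` limit `G` of the mixtures. Its set integrals must agree with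
the setwise limit, so `G` equals the true density almost everywhere, even though the parameters need
not converge to `ξ₀`. -/
lemma tendsto_integral_abs_sub_of_two_le (hp : 1 ≤ p) (hn : 2 ≤ n)
    (hu : ∀ᶠ ξ in u, ξ ∈ paramSpace n p C) {ξ₀ : MixParam n p C}
    (hlim : ∀ A, MeasurableSet A → Tendsto (mixProb h A : MixParam n p C → ℝ) u (𝓝 (mixProb h A ξ₀))) :
    Tendsto (fun ξ : MixParam n p C => ∫ X, |mixDensity h ξ X - mixDensity h ξ₀ X|
        ∂(stiefelHaar h)) u (𝓝 0) := by
  choose g hg hgl using exists_tendsto_weighted_mlDensity h hp hn hu hlim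
  set G : Stiefel n p → ℝ := fun X => ∑ c, g c X with hG
  have hGi : Integrable G (stiefelHaar h) := integrable_finsetSum _ fun c _ => hg c
  have hci : ∀ (ξ : MixParam n p C) c, Integrable (fun X => ξ.2 c * mlDensity h (ξ.1 c) X - g c X)
      (stiefelHaar h) := fun ξ c => ((integrable_of_continuous_of_compactSpace
    (continuous_mlDensity_right h _)).const_mul _).sub (hg c)
  have hGlim : Tendsto (fun ξ : MixParam n p C => ∫ X, |mixDensity h ξ X - G X|
        ∂(stiefelHaar h)) u (𝓝 0) := by
    have hsum := tendsto_finsetSum Finset.univ fun c _ => hgl c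
    rw [Finset.sum_const_zero] at hsum
    refine squeeze_zero (fun ξ => integral_nonneg fun X => abs_nonneg _) (fun ξ => ?_) hsum
    rw [← integral_finsetSum _ fun c _ => (hci ξ c).abs]
    refine integral_mono ((integrable_mixDensity h ξ).sub hGi).abs
      (integrable_finsetSum _ fun c _ => (hci ξ c).abs) fun X => ?_
    simp only [mixDensity, hG]
    rw [← Finset.sum_sub_distrib]
    exact Finset.abs_sum_le_sum_abs _ _
  have hset : ∀ A, MeasurableSet A → ∫ X in A, G X ∂(stiefelHaar h) =
      ∫ X in A, mixDensity h ξ₀ X ∂(stiefelHaar h) := by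
    intro A hA
    refine tendsto_nhds_unique (f := mixProb h A) (l := (u : Filter (MixParam n p C))) ?_
      (hlim A hA)
    rw [tendsto_iff_dist_tendsto_zero]
    refine squeeze_zero (fun ξ => dist_nonneg) (fun ξ => ?_) hGlim
    rw [Real.dist_eq, mixProb, ← integral_sub (integrable_mixDensity h ξ) hGi.integrableOn]
    exact (abs_integral_le_integral_abs).trans (setIntegral_le_integral
      ((integrable_mixDensity h ξ).sub hGi).abs (ae_of_all _ fun X => abs_nonneg _))
  have hae : G =ᵐ[stiefelHaar h] mixDensity h ξ₀ :=
    hGi.ae_eq_of_forall_setIntegral_eq _ _ (integrable_mixDensity h ξ₀) fun A hA _ => hset A hA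
  refine hGlim.congr fun ξ => integral_congr_ae ?_
  filter_upwards [hae] with X hX
  rw [hX]

/-! ### The finite case -/

lemma finite_stiefel_one (p : ℕ) : Finite (Stiefel 1 p) := by
  have h1 : Set.Finite (Set.univ.pi fun _ : Fin 1 => Set.univ.pi fun _ : Fin p => ({1, -1} : Set ℝ)) :=
    Set.Finite.pi fun _ => Set.Finite.pi fun _ => Set.toFinite _
  refine Set.Finite.subset (s := (Set.univ.pi fun _ : Fin 1 => Set.univ.pi fun _ : Fin p =>
    ({1, -1} : Set ℝ))) h1 fun X hX => ?_
  intro i _ j _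
  have h2 := sum_sq_column ⟨X, hX⟩ j
  rw [Fin.sum_univ_one] at h2
  rw [Subsingleton.elim i 0]
  simpa using h2

lemma tendsto_integral_abs_sub_of_finite [Finite (Stiefel n p)] {ξ₀ : MixParam n p C}
    (hlim : ∀ A, MeasurableSet A → Tendsto (mixProb h A : MixParam n p C → ℝ) u (𝓝 (mixProb h A ξ₀))) :
    Tendsto (fun ξ : MixParam n p C => ∫ X, |mixDensity h ξ X - mixDensity h ξ₀ X|
        ∂(stiefelHaar h)) u (𝓝 0) := by
  have := Fintype.ofFinite (Stiefel n p)
  have hint : ∀ ξ : MixParam n p C, ∫ X, |mixDensity h ξ X - mixDensity h ξ₀ X| ∂(stiefelHaar h) =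
      ∑ X, |mixProb h {X} ξ - mixProb h {X} ξ₀| := by
    intro ξ
    rw [integral_fintype (f := fun X => |mixDensity h ξ X - mixDensity h ξ₀ X|)
      ((integrable_mixDensity h ξ).sub (integrable_mixDensity h ξ₀)).abs]
    refine Finset.sum_congr rfl fun X _ => ?_
    rw [mixProb, mixProb, integral_singleton, integral_singleton, smul_eq_mul, smul_eq_mul,
      smul_eq_mul, ← mul_sub, abs_mul, abs_of_nonneg measureReal_nonneg]
  simp_rw [hint]
  have h1 : Tendsto (fun ξ : MixParam n p C => ∑ X, |mixProb h {X} ξ - mixProb h {X} ξ₀|) u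
      (𝓝 (∑ X : Stiefel n p, |mixProb h {X} ξ₀ - mixProb h {X} ξ₀|)) :=
    tendsto_finsetSum _ fun X _ =>
      ((hlim _ (measurableSet_singleton X)).sub tendsto_const_nhds).abs
  simpa using h1

/-- Pointwise, `(√a - √b)² ≤ |√a - √b| (√a + √b) = |a - b|`. -/
lemma integral_sq_sqrt_sub_le {ξ ξ₀ : MixParam n p C} (hξ : ξ.2 ∈ openSimplex C)
    (hξ₀ : ξ₀.2 ∈ openSimplex C) :
    ∫ X, (Real.sqrt (mixDensity h ξ₀ X) - Real.sqrt (mixDensity h ξ X)) ^ 2 ∂(stiefelHaar h) ≤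
      ∫ X, |mixDensity h ξ X - mixDensity h ξ₀ X| ∂(stiefelHaar h) := by
  refine integral_mono (integrable_of_continuous_of_compactSpace
    (((continuous_mixDensity_right h ξ₀).sqrt.sub (continuous_mixDensity_right h ξ).sqrt).pow 2))
    ((integrable_mixDensity h ξ).sub (integrable_mixDensity h ξ₀)).abs fun X => ?_
  have ha := (mixDensity_pos h hξ X).le
  have hb := (mixDensity_pos h hξ₀ X).le
  have hsa := Real.sqrt_nonneg (mixDensity h ξ X)
  have hsb := Real.sqrt_nonneg (mixDensity h ξ₀ X)
  have h1 : mixDensity h ξ X - mixDensity h ξ₀ X =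
      (Real.sqrt (mixDensity h ξ X) - Real.sqrt (mixDensity h ξ₀ X)) *
      (Real.sqrt (mixDensity h ξ X) + Real.sqrt (mixDensity h ξ₀ X)) := by
    nlinarith [Real.sq_sqrt ha, Real.sq_sqrt hb]
  simp only
  rw [h1, abs_mul, ← sq_abs, pow_two, abs_sub_comm]
  refine mul_le_mul_of_nonneg_left ?_ (abs_nonneg _)
  rw [abs_of_nonneg (add_nonneg hsa hsb), abs_le]
  constructor <;> linarith

theorem hellingerNhd_mem_ultrafilter (hp : 1 ≤ p) (hu : ∀ᶠ ξ in u, ξ ∈ paramSpace n p C)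
    {ξ₀ : MixParam n p C} (hξ₀ : ξ₀ ∈ paramSpace n p C)
    (hlim : ∀ A, MeasurableSet A → Tendsto (mixProb h A : MixParam n p C → ℝ) u (𝓝 (mixProb h A ξ₀)))
    {ε : ℝ} (hε : 0 < ε) : hellingerNhd h ξ₀ ε ∈ u := by
  have hL1 : Tendsto (fun ξ : MixParam n p C => ∫ X, |mixDensity h ξ X - mixDensity h ξ₀ X|
        ∂(stiefelHaar h)) u (𝓝 0) := by
    rcases Nat.lt_or_ge n 2 with hn | hn
    · obtain rfl : n = 1 := by omega
      have := finite_stiefel_one p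
      exact tendsto_integral_abs_sub_of_finite h hlim
    · exact tendsto_integral_abs_sub_of_two_le h hp hn hu hlim
  filter_upwards [hu, hL1.eventually_lt_const (pow_pos hε 2)] with ξ hξ hlt
  exact ⟨hξ, (Real.sqrt_lt' hε).2 ((integral_sq_sqrt_sub_le h hξ.2 hξ₀.2).trans_lt hlt)⟩

end Ultrafilter

end StiefelMixture

end

theorem mainTheorem6 {n p C : ℕ} (hp : 1 ≤ p) (hpn : p ≤ n)
    (H : StiefelMixture.Hyper n p C)
    (hν : ∀ c, 0 < H.ν c)
    (hη : ∀ c, IntegrableOn (StiefelMixture.imdyDensity hpn (H.ν c) (H.η c))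
      (StiefelMixture.posOrthant p) volume)
    (hα : ∀ c, 0 < H.α c)
    (ξ₀ : StiefelMixture.MixParam n p C) (hξ₀ : ξ₀ ∈ StiefelMixture.paramSpace n p C) :
    IsProbabilityMeasure (StiefelMixture.prior hpn H) ∧
    IsProbabilityMeasure (StiefelMixture.mixMeasure hpn ξ₀) ∧
    (∀ᵐ x ∂(Measure.infinitePi fun _ : ℕ => StiefelMixture.mixMeasure hpn ξ₀), ∀ N : ℕ,
      StiefelMixture.evidence hpn H ξ₀ x N (StiefelMixture.paramSpace n p C) ≠ 0 ∧
      StiefelMixture.evidence hpn H ξ₀ x N (StiefelMixture.paramSpace n p C) ≠ ⊤) ∧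
    ∀ ε : ℝ, 0 < ε →
      ∀ᵐ x ∂(Measure.infinitePi fun _ : ℕ => StiefelMixture.mixMeasure hpn ξ₀),
        Tendsto (fun N : ℕ => StiefelMixture.posterior hpn H ξ₀ x N
          (StiefelMixture.paramSpace n p C \ StiefelMixture.hellingerNhd hpn ξ₀ ε))
          atTop (𝓝 0) := by
  have hprior := StiefelMixture.isProbabilityMeasure_prior hpn hη hα hξ₀
  refine ⟨hprior, StiefelMixture.isProbabilityMeasure_mixMeasure hpn hξ₀.2, ?_, fun ε hε => ?_⟩
  · obtain ⟨c, hc0, -, hlow⟩ := StiefelMixture.exists_evidence_lower_bound hpn hη hα hξ₀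
      (s := 1 / 2) (by norm_num) (by norm_num)
    filter_upwards [StiefelMixture.ae_evidence_ne_top hpn (H := H) hξ₀.2] with x hx N
    refine ⟨fun h0 => ?_, hx N⟩
    have h1 := hlow x N
    rw [h0, le_zero_iff, mul_eq_zero] at h1
    exact h1.elim (pow_ne_zero N (ENNReal.ofReal_pos.2 (by norm_num)).ne') hc0
  · have hmem : StiefelMixture.hellingerNhd hpn ξ₀ ε ∈
        StiefelMixture.concentrationFilter hpn H ξ₀ := by
      -- A set belongs to a filter as soon as it belongs to every finer ultrafilter; these provide
      -- the subsequence-like limits used in the compactness argument.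
      rw [Filter.mem_iff_ultrafilter]
      intro u hu
      exact StiefelMixture.hellingerNhd_mem_ultrafilter hpn hp
        (hu (StiefelMixture.paramSpace_mem_concentrationFilter hpn H ξ₀)) hξ₀
        (fun A hA => (StiefelMixture.tendsto_mixProb_concentrationFilter hpn hη hα hξ₀ hA).mono_left
          hu) hε
    exact hmem
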